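/- Let $n\in\mathbb N$, let $\Theta=\{\theta\in\mathbb R^{n\times n}:\rho(\theta)<1\}$ be the set of (asymptotically) stable matrices, where $\rho$ denotes the largest modulus of a complex eigenvalue, and let $S_w,Q\in\mathbb R^{n\times n}$ be symmetric positive definite. For each $\theta\in\Theta$ consider the linear system $x_{t+1}=\theta x_t+w_t$ whose disturbances $w_t$ are i.i.d. and independent of $x_0$, with mean zero, covariance matrix $S_w$ and an everywhere positive probability density function. Let $S_\theta$ be the covariance matrix of the invariant distribution of the Markov chain $(x_t)$, and set $$I(\theta',\theta)=\tfrac12\,\mathrm{tr}\bigl(S_w^{-1}(\theta'-\theta)S_\theta(\theta'-\theta)^{\mathsf T}\bigr),\qquad \theta'\in\mathbb R^{n\times n},\ \theta\in\Theta .$$ Fix an unstable matrix $\theta'\in\mathbb R^{n\times n}\setminus\Theta$ and consider, for $r\in\mathbb R$, the problem $$\min_{\theta\in\Theta}\{\mathrm{tr}(QS_\theta):\ I(\theta',\theta)\le r\}.\tag{1}$$ Let $\underline r$ be the infimum of all $r\ge 0$ for which (1) is feasible, and let $\overline r=I(\theta',0)$. **Proposition (Optimal solution of (1)).** There is a function $\varphi:(\underline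 r,\overline r)\to(0,\infty)$ that is real analytic, strictly increasing and bijective such that the following hold. (i) For every $\delta\in(0,\infty)$ the Riccati equation $$P=Q+\theta'^{\mathsf T}P\,(I_n+2\delta S_wP)^{-1}\theta'$$ has a unique symmetric positive definite solution $P_\delta$. (ii) For every $\delta\in(0,\infty)$ the matrix $\theta^\star_\delta=(I_n+2\delta S_wP_\delta)^{-1}\theta'$ is the unique solution of problem (1) at $r=\varphi^{-1}(\delta)$, and the rate constraint is binding at optimality, that is, $I(\theta',\theta^\star_\delta)=r$. -/

import Mathlib

open Matrix MeasureTheory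

namespace StableId

noncomputable section

/-- The set `Θ` of asymptotically stable real `n × n` matrices: the largest modulus of a complex
eigenvalue is smaller than one. -/
def stableSet (n : ℕ) : Set (Matrix (Fin n) (Fin n) ℝ) :=
  {θ | spectralRadius ℂ (θ.map (fun a : ℝ => (a : ℂ))) < 1}

/-- `μ` is an admissible law of the disturbances `w_t`: a probability measure on `ℝⁿ` with finite
second moments, mean zero, second moment matrix `𝔼[w wᵀ] = Sw`, and an everywhere positive
probability density function. -/
structure IsNoiseLaw {n : ℕ} (Sw : Matrix (Fin n) (Fin n) ℝ) (μ : Measure (Fin n → ℝ)) :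
    Prop where
  isProbabilityMeasure : IsProbabilityMeasure μ
  memLp : ∀ i, MemLp (fun w : Fin n → ℝ => w i) 2 μ
  mean_zero : ∀ i, ∫ w, w i ∂μ = 0
  second_moment : ∀ i j, ∫ w, w i * w j ∂μ = Sw i j
  pos_density : ∃ p : (Fin n → ℝ) → ℝ, Measurable p ∧ (∀ w, 0 < p w) ∧
    μ = (volume : Measure (Fin n → ℝ)).withDensity (fun w => ENNReal.ofReal (p w))

/-- `ν` is an invariant distribution of the Markov chain `x_{t+1} = θ x_t + w_t` whose disturbances
are i.i.d. with law `μ` and independent of the initial state: if `x ∼ ν` and `w ∼ μ` are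
independent, then `θ x + w ∼ ν`. -/
def IsInvariantLaw {n : ℕ} (θ : Matrix (Fin n) (Fin n) ℝ) (μ ν : Measure (Fin n → ℝ)) : Prop :=
  IsProbabilityMeasure ν ∧
    (ν.prod μ).map (fun p : (Fin n → ℝ) × (Fin n → ℝ) => θ *ᵥ p.1 + p.2) = ν

open Classical in
/-- The invariant state distribution `ν_θ`. For stable `θ` and an admissible noise law `μ` it exists
and is unique. -/
def invariantLaw {n : ℕ} (θ : Matrix (Fin n) (Fin n) ℝ) (μ : Measure (Fin n → ℝ)) :
    Measure (Fin n → ℝ) :=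
  if h : ∃ ν, IsInvariantLaw θ μ ν then h.choose else 0

/-- The covariance matrix `S_θ` of the invariant state distribution `ν_θ`, where the disturbances
have law `μ θ` under the model `θ`. -/
def stateCov {n : ℕ} (μ : Matrix (Fin n) (Fin n) ℝ → Measure (Fin n → ℝ))
    (θ : Matrix (Fin n) (Fin n) ℝ) : Matrix (Fin n) (Fin n) ℝ :=
  Matrix.of fun i j =>
    ProbabilityTheory.covariance (fun x : Fin n → ℝ => x i) (fun x : Fin n → ℝ => x j)
      (invariantLaw θ (μ θ))

/-- The discrepancy function `I(θ', θ) = ½ tr(Sw⁻¹ (θ' - θ) S_θ (θ' - θ)ᵀ)`. -/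
def rateFun {n : ℕ} (Sw : Matrix (Fin n) (Fin n) ℝ)
    (μ : Matrix (Fin n) (Fin n) ℝ → Measure (Fin n → ℝ))
    (θ' θ : Matrix (Fin n) (Fin n) ℝ) : ℝ :=
  1 / 2 * trace (Sw⁻¹ * (θ' - θ) * stateCov μ θ * (θ' - θ)ᵀ)

/-- The feasible set `{θ ∈ Θ : I(θ', θ) ≤ r}`. -/
def feasibleSet {n : ℕ} (Sw : Matrix (Fin n) (Fin n) ℝ)
    (μ : Matrix (Fin n) (Fin n) ℝ → Measure (Fin n → ℝ))
    (θ' : Matrix (Fin n) (Fin n) ℝ) (r : ℝ) : Set (Matrix (Fin n) (Fin n) ℝ) :=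
  {θ | θ ∈ stableSet n ∧ rateFun Sw μ θ' θ ≤ r}

/-- `θ` solves the problem `min {tr(Q S_θ) : θ ∈ Θ, I(θ', θ) ≤ r}`. -/
def IsSolution {n : ℕ} (Sw : Matrix (Fin n) (Fin n) ℝ)
    (μ : Matrix (Fin n) (Fin n) ℝ → Measure (Fin n → ℝ))
    (Q θ' : Matrix (Fin n) (Fin n) ℝ) (r : ℝ) (θ : Matrix (Fin n) (Fin n) ℝ) : Prop :=
  θ ∈ feasibleSet Sw μ θ' r ∧
    IsMinOn (fun η => trace (Q * stateCov μ η)) (feasibleSet Sw μ θ' r) θ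

/-- The infimum of the radii `r ≥ 0` for which the problem is feasible. -/
def rLow {n : ℕ} (Sw : Matrix (Fin n) (Fin n) ℝ)
    (μ : Matrix (Fin n) (Fin n) ℝ → Measure (Fin n → ℝ))
    (θ' : Matrix (Fin n) (Fin n) ℝ) : ℝ :=
  sInf {r : ℝ | 0 ≤ r ∧ (feasibleSet Sw μ θ' r).Nonempty}

/-- The radius `I(θ', 0)`. -/
def rHigh {n : ℕ} (Sw : Matrix (Fin n) (Fin n) ℝ)
    (μ : Matrix (Fin n) (Fin n) ℝ → Measure (Fin n → ℝ))
    (θ' : Matrix (Fin n) (Fin n) ℝ) : ℝ :=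
  rateFun Sw μ θ' 0

/-- `P` is a positive definite (in particular symmetric) solution of the Riccati equation
`P = Q + θ'ᵀ P (I + 2 δ Sw P)⁻¹ θ'`. -/
def IsRiccatiSolution {n : ℕ} (Sw Q θ' : Matrix (Fin n) (Fin n) ℝ) (δ : ℝ)
    (P : Matrix (Fin n) (Fin n) ℝ) : Prop :=
  P.PosDef ∧ P = Q + θ'ᵀ * P * (1 + (2 * δ) • (Sw * P))⁻¹ * θ'

/-- The matrix `(I + 2 δ Sw P)⁻¹ θ'`. -/
def thetaStar {n : ℕ} (Sw θ' : Matrix (Fin n) (Fin n) ℝ) (δ : ℝ)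
    (P : Matrix (Fin n) (Fin n) ℝ) : Matrix (Fin n) (Fin n) ℝ :=
  (1 + (2 * δ) • (Sw * P))⁻¹ * θ'

end

end StableId

open StableId

/-!
Write `K` for the noise covariance, `A` for the unstable matrix, `c θ = tr (Q S_θ)` for the cost and
`I θ` for the rate of a stable matrix `θ`.

For `δ > 0` consider the penalized problem of minimizing `δ c + I` over the stable matrices, a
linear-quadratic regulator problem. With `W = δ P`, its Riccati equation is `W = δ Q + Aᵀ W (1 + 2 K
W)⁻¹ A`. Completing the square (`cost_eq`) shows that the penalized objective at `θ` equals `tr (W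
K)` plus a term that is positive definite in `θ - γ`, where `γ = (1 + 2 K W)⁻¹ A`. Hence `γ` is the
unique minimizer, and `W` is determined by `γ` through a Lyapunov equation (`riccati_unique`). A
solution exists because the penalized objective has a minimizer by compactness, and a minimizer that
cannot be improved by one step of policy iteration yields a solution (`riccati_exists`). A minimizer
of `δ c + I` also minimizes `c` among all `θ` with `I θ ≤ I γ`, uniquely and with a binding
constraint. It remains to show that `δ ↦ I γ_δ` is an analytic bijection from the positive reals
onto the interval of radii, with positive derivative; `φ` is its inverse.

The pair `(W, γ)` solves polynomial equations whose linearization reduces to a Lyapunov equation, so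
it is analytic in `δ` by the inverse function theorem (`riccati_analyticAt`). The value `v δ = tr (W
K) = δ c + I` is a minimum of affine functions of `δ`, so `v' = c` (`hasDerivAt_value`), and the
rate is `v - δ v'`, with derivative `-δ c'`. The optimality gap between two parameters gives
`c' ≤ -tr (G (η S ηᵀ))` with `G = ½ K⁻¹ + W` and `S = S_γ` positive definite and `η` the
derivative of `γ`, which does not vanish because `A ≠ 0` (`deriv_cost_neg`). The limits at the endpoints follow by comparing `γ_δ`
with a fixed stable matrix.

The connection with the Markov chain is `stateCov_lyapunov`: for stable `θ` the invariant law
exists, is unique and has finite second moments, so that its covariance satisfies `S = θ S θᵀ + K`.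
-/

/-! ### Stability through powers -/

namespace StableId
open Filter Topology

section Stability

attribute [local instance] Matrix.linftyOpNormedRing Matrix.linftyOpNormedAlgebra

variable {n : ℕ}

theorem norm_map_ofReal (M : Matrix (Fin n) (Fin n) ℝ) :
    ‖M.map (fun a : ℝ => (a : ℂ))‖ = ‖M‖ := by
  simp [Matrix.linfty_opNorm_def]

theorem map_ofReal_pow (M : Matrix (Fin n) (Fin n) ℝ) (k : ℕ) :
    (M ^ k).map (fun a : ℝ => (a : ℂ)) = (M.map (fun a : ℝ => (a : ℂ))) ^ k :=
  map_pow (Complex.ofRealHom.mapMatrix : Matrix (Fin n) (Fin n) ℝ →+* _) M k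

/-- A contractive power already forces stability, since the spectral radius is bounded by
`‖θ ^ k‖ ^ (1 / k)`; this makes stability an open condition. -/
theorem mem_stableSet_of_norm_pow_lt_one {θ : Matrix (Fin n) (Fin n) ℝ} {k : ℕ} (hk : k ≠ 0)
    (h : ‖θ ^ k‖ < 1) : θ ∈ stableSet n := by
  rcases Nat.eq_zero_or_pos n with rfl | hn
  · have : θ.map (fun a : ℝ => (a : ℂ)) = 0 := Subsingleton.elim _ _
    simp only [stableSet, Set.mem_ofPred_eq, this]
    rw [spectrum.spectralRadius_zero]; norm_num
  have : Nonempty (Fin n) := ⟨⟨0, hn⟩⟩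
  obtain ⟨m, rfl⟩ := Nat.exists_eq_succ_of_ne_zero hk
  have h1 := spectrum.spectralRadius_le_pow_nnnorm_pow_one_div ℂ (θ.map (fun a : ℝ => (a : ℂ))) m
  refine lt_of_le_of_lt h1 ?_
  rw [← map_ofReal_pow, nnnorm_one, ENNReal.coe_one, ENNReal.one_rpow, mul_one]
  refine ENNReal.rpow_lt_one ?_ (by positivity)
  rw [ENNReal.coe_lt_one_iff, ← NNReal.coe_lt_one, coe_nnnorm, norm_map_ofReal]
  exact h

/-- Powers of a stable matrix decay geometrically, by Gelfand's formula. -/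
theorem exists_norm_pow_le {θ : Matrix (Fin n) (Fin n) ℝ} (h : θ ∈ stableSet n) :
    ∃ c : ℝ, 0 ≤ c ∧ c < 1 ∧ ∀ᶠ k : ℕ in atTop, ‖θ ^ k‖ ≤ c ^ k := by
  have h1 := spectrum.pow_norm_pow_one_div_tendsto_nhds_spectralRadius
    (θ.map (fun a : ℝ => (a : ℂ)))
  obtain ⟨c, hc, hc1⟩ :=
    exists_between (show spectralRadius ℂ (θ.map (fun a : ℝ => (a : ℂ))) < 1 from h)
  have hev := h1.eventually (gt_mem_nhds hc)
  have hctop : c ≠ ⊤ := (hc1.trans ENNReal.one_lt_top).ne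
  lift c to NNReal using hctop
  refine ⟨c, c.2, by exact_mod_cast hc1, ?_⟩
  filter_upwards [hev, eventually_gt_atTop 0] with k hk hk0
  rw [← map_ofReal_pow, norm_map_ofReal, ← ENNReal.ofReal_coe_nnreal,
    ENNReal.ofReal_lt_ofReal_iff_of_nonneg (by positivity)] at hk
  have := Real.rpow_le_rpow (by positivity) hk.le (by positivity : (0 : ℝ) ≤ k)
  rwa [← Real.rpow_mul (norm_nonneg _), one_div, inv_mul_cancel₀ (by positivity), Real.rpow_one,
    Real.rpow_natCast] at this

theorem mem_stableSet_iff_tendsto {θ : Matrix (Fin n) (Fin n) ℝ} :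
    θ ∈ stableSet n ↔ Tendsto (fun k : ℕ => θ ^ k) atTop (𝓝 0) := by
  constructor
  · intro h
    obtain ⟨c, hc0, hc1, hc⟩ := exists_norm_pow_le h
    exact squeeze_zero_norm' hc (tendsto_pow_atTop_nhds_zero_of_lt_one hc0 hc1)
  · intro h
    have h1 : ∀ᶠ k in atTop, ‖θ ^ k‖ < 1 :=
      (tendsto_zero_iff_norm_tendsto_zero.1 h).eventually (gt_mem_nhds one_pos)
    obtain ⟨k, hk, hk0⟩ := (h1.and (eventually_gt_atTop 0)).exists
    exact mem_stableSet_of_norm_pow_lt_one hk0.ne' hk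

theorem isOpen_stableSet : IsOpen (stableSet n) := by
  rw [isOpen_iff_mem_nhds]
  intro θ hθ
  have h1 : ∀ᶠ k in atTop, ‖θ ^ k‖ < 1 :=
      (tendsto_zero_iff_norm_tendsto_zero.1 (mem_stableSet_iff_tendsto.1 hθ)).eventually
        (gt_mem_nhds one_pos)
  obtain ⟨k, hk, hk0⟩ := (h1.and (eventually_gt_atTop 0)).exists
  have : ∀ᶠ η in 𝓝 θ, ‖η ^ k‖ < 1 :=
    (Continuous.tendsto (by fun_prop) θ).eventually (gt_mem_nhds hk)
  filter_upwards [this] with η hη using mem_stableSet_of_norm_pow_lt_one hk0.ne' hη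

theorem transpose_mem_stableSet {θ : Matrix (Fin n) (Fin n) ℝ} (h : θ ∈ stableSet n) :
    θᵀ ∈ stableSet n := by
  rw [mem_stableSet_iff_tendsto] at h ⊢
  have := (Continuous.matrix_transpose continuous_id).tendsto
    (0 : Matrix (Fin n) (Fin n) ℝ) |>.comp h
  simpa [Function.comp_def, Matrix.transpose_pow] using this

theorem zero_mem_stableSet : (0 : Matrix (Fin n) (Fin n) ℝ) ∈ stableSet n :=
  mem_stableSet_of_norm_pow_lt_one one_ne_zero (by simp)

end Stability
end StableId

/-! ### Traces of positive definite matrices and Lyapunov equations -/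

namespace StableId
open Filter Topology

section Lyapunov

variable {n : ℕ}

theorem isClosed_posSemidef : IsClosed {M : Matrix (Fin n) (Fin n) ℝ | M.PosSemidef} := by
  simp only [posSemidef_iff_dotProduct_mulVec, Set.ofPred_and, Set.ofPred_forall, IsHermitian,
    conjTranspose_eq_transpose_of_trivial]
  refine (isClosed_eq (by fun_prop) continuous_id).inter (isClosed_iInter fun x => ?_)
  exact isClosed_le continuous_const (by fun_prop)

theorem _root_.Matrix.PosDef.exists_posSemidef_sub_smul_one {M : Matrix (Fin n) (Fin n) ℝ}
    (hM : M.PosDef) : ∃ ε : ℝ, 0 < ε ∧ (M - ε • (1 : Matrix (Fin n) (Fin n) ℝ)).PosSemidef := by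
  -- the minimum of the quadratic form over the sphere of the sup norm, where `x ⬝ᵥ x ≤ n`
  let s : Set (Fin n → ℝ) := Metric.sphere 0 1
  have hs : IsCompact s := isCompact_sphere 0 1
  have hcont : ContinuousOn (fun x : Fin n → ℝ => x ⬝ᵥ (M *ᵥ x)) s := by fun_prop
  have hpos : ∀ x ∈ s, 0 < x ⬝ᵥ (M *ᵥ x) := by
    intro x hx
    have hx0 : x ≠ 0 := by
      rintro rfl
      simp [s] at hx
    simpa using hM.dotProduct_mulVec_pos hx0
  obtain ⟨c, hc, hcs⟩ := hs.exists_forall_le' hcont hpos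
  have hsq : ∀ x : Fin n → ℝ, x ⬝ᵥ x ≤ n * ‖x‖ ^ 2 := by
    intro x
    calc x ⬝ᵥ x ≤ ∑ _i : Fin n, ‖x‖ ^ 2 := by
          refine Finset.sum_le_sum fun i _ => ?_
          have := norm_le_pi_norm x i
          rw [Real.norm_eq_abs] at this
          nlinarith [abs_mul_abs_self (x i), abs_nonneg (x i)]
      _ = _ := by simp
  refine ⟨c / (n + 1), by positivity, PosSemidef.of_dotProduct_mulVec_nonneg ?_ fun x => ?_⟩
  · exact hM.1.sub (by simp [IsHermitian])
  · have h1 : c * ‖x‖ ^ 2 ≤ x ⬝ᵥ (M *ᵥ x) := by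
      rcases eq_or_ne x 0 with rfl | hx
      · simp
      · have := hcs (‖x‖⁻¹ • x) (by simp [s, norm_smul, hx])
        rw [mulVec_smul, dotProduct_smul, smul_dotProduct, smul_eq_mul, smul_eq_mul] at this
        have hx' : 0 < ‖x‖ := norm_pos_iff.2 hx
        calc c * ‖x‖ ^ 2 ≤ (‖x‖⁻¹ * (‖x‖⁻¹ * x ⬝ᵥ (M *ᵥ x))) * ‖x‖ ^ 2 := by gcongr
          _ = _ := by field_simp
    have h2 : c / (n + 1) * (x ⬝ᵥ x) ≤ c * ‖x‖ ^ 2 := by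
      rw [div_mul_eq_mul_div, div_le_iff₀ (by positivity)]
      have := mul_le_mul_of_nonneg_left (hsq x) hc.le
      nlinarith [sq_nonneg ‖x‖]
    simp only [star_trivial, sub_mulVec, dotProduct_sub, smul_mulVec, one_mulVec, dotProduct_smul,
      smul_eq_mul]
    linarith

theorem _root_.Matrix.PosSemidef.trace_mul_nonneg {M N : Matrix (Fin n) (Fin n) ℝ}
    (hM : M.PosSemidef) (hN : N.PosSemidef) : 0 ≤ trace (M * N) := by
  obtain ⟨B, rfl⟩ : ∃ B : Matrix (Fin n) (Fin n) ℝ, N = Bᴴ * B := by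
    open scoped MatrixOrder in
    exact CStarAlgebra.nonneg_iff_eq_star_mul_self.1 hN.nonneg
  rw [← Matrix.mul_assoc, trace_mul_comm, ← Matrix.mul_assoc]
  exact (hM.mul_mul_conjTranspose_same B).trace_nonneg

theorem _root_.Matrix.PosSemidef.mul_mul_transpose {M : Matrix (Fin n) (Fin n) ℝ}
    (hM : M.PosSemidef) (X : Matrix (Fin n) (Fin n) ℝ) : (X * M * Xᵀ).PosSemidef := by
  simpa using hM.mul_mul_conjTranspose_same X

/-- The quadratic form `X ↦ tr (N X S Xᵀ)` dominates a multiple of the squared Frobenius norm. -/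
theorem exists_le_trace_mul {N S : Matrix (Fin n) (Fin n) ℝ} (hN : N.PosDef) (hS : S.PosDef) :
    ∃ ε : ℝ, 0 < ε ∧ ∀ X : Matrix (Fin n) (Fin n) ℝ,
      ε * trace (X * Xᵀ) ≤ trace (N * (X * S * Xᵀ)) := by
  obtain ⟨a, ha, hNa⟩ := hN.exists_posSemidef_sub_smul_one
  obtain ⟨b, hb, hSb⟩ := hS.exists_posSemidef_sub_smul_one
  refine ⟨a * b, by positivity, fun X => ?_⟩
  have h1 := hNa.trace_mul_nonneg (hS.posSemidef.mul_mul_transpose X)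
  have h2 := (hSb.mul_mul_transpose X).trace_nonneg
  simp only [Matrix.sub_mul, Matrix.mul_sub, Matrix.smul_mul, Matrix.mul_smul, Matrix.one_mul,
    Matrix.mul_one, trace_sub, trace_smul, smul_eq_mul] at h1 h2
  nlinarith

theorem trace_mul_transpose_self (X : Matrix (Fin n) (Fin n) ℝ) :
    trace (X * Xᵀ) = ∑ i, ∑ j, X i j ^ 2 := by
  simp [trace, Matrix.mul_apply, sq]

theorem sq_apply_le_trace (X : Matrix (Fin n) (Fin n) ℝ) (i j : Fin n) :
    X i j ^ 2 ≤ trace (X * Xᵀ) := by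
  rw [trace_mul_transpose_self]
  exact (Finset.single_le_sum (f := fun j => X i j ^ 2) (fun _ _ => sq_nonneg _)
    (Finset.mem_univ j)).trans
    (Finset.single_le_sum (f := fun i => ∑ j, X i j ^ 2)
      (fun _ _ => Finset.sum_nonneg fun _ _ => sq_nonneg _) (Finset.mem_univ i))

theorem trace_mul_conj_pos {N S X : Matrix (Fin n) (Fin n) ℝ} (hN : N.PosDef) (hS : S.PosDef)
    (hX : X ≠ 0) : 0 < trace (N * (X * S * Xᵀ)) := by
  obtain ⟨ε, hε, h⟩ := exists_le_trace_mul hN hS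
  refine lt_of_lt_of_le (mul_pos hε ?_) (h X)
  obtain ⟨i, j, hij⟩ : ∃ i j, X i j ≠ 0 := by
    by_contra! hc
    exact hX (by ext i j; exact hc i j)
  exact lt_of_lt_of_le (by positivity) (sq_apply_le_trace X i j)

theorem tendsto_zero_of_trace {ι : Type*} {l : Filter ι} {N S : Matrix (Fin n) (Fin n) ℝ}
    (hN : N.PosDef) (hS : S.PosDef) {X : ι → Matrix (Fin n) (Fin n) ℝ}
    (h : Tendsto (fun k => trace (N * (X k * S * (X k)ᵀ))) l (𝓝 0)) : Tendsto X l (𝓝 0) := by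
  obtain ⟨ε, hε, hle⟩ := exists_le_trace_mul hN hS
  refine tendsto_pi_nhds.2 fun i => tendsto_pi_nhds.2 fun j => ?_
  have h1 : Tendsto (fun k => X k i j ^ 2) l (𝓝 0) := by
    refine squeeze_zero (fun _ => sq_nonneg _) (fun k => ?_)
      (by simpa using h.const_mul ε⁻¹)
    rw [inv_mul_eq_div, le_div_iff₀ hε]
    nlinarith [sq_apply_le_trace (X k) i j, hle (X k)]
  have h2 := h1.sqrt
  simp only [Real.sqrt_sq_eq_abs, Real.sqrt_zero] at h2
  exact (tendsto_zero_iff_abs_tendsto_zero _).2 h2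

theorem lyapunov_iterate {θ S M : Matrix (Fin n) (Fin n) ℝ} (h : S = θ * S * θᵀ + M) (k : ℕ) :
    S = θ ^ k * S * (θ ^ k)ᵀ + ∑ j ∈ Finset.range k, θ ^ j * M * (θ ^ j)ᵀ := by
  induction k with
  | zero => simp
  | succ k ih =>
    rw [Finset.sum_range_succ]
    nth_rw 1 [ih]
    nth_rw 1 [h]
    rw [pow_succ, transpose_mul]
    noncomm_ring

theorem tendsto_conj_zero {θ : Matrix (Fin n) (Fin n) ℝ} (hθ : θ ∈ stableSet n)
    (S : Matrix (Fin n) (Fin n) ℝ) :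
    Tendsto (fun k : ℕ => θ ^ k * S * (θ ^ k)ᵀ) atTop (𝓝 0) := by
  have hc : Continuous fun X : Matrix (Fin n) (Fin n) ℝ => X * S * Xᵀ := by fun_prop
  simpa [Function.comp_def] using (hc.tendsto 0).comp (mem_stableSet_iff_tendsto.1 hθ)

theorem eq_zero_of_eq_conj {θ S : Matrix (Fin n) (Fin n) ℝ} (hθ : θ ∈ stableSet n)
    (h : S = θ * S * θᵀ) : S = 0 := by
  have h0 : S = θ * S * θᵀ + 0 := by simpa using h
  refine tendsto_nhds_unique ?_ (tendsto_conj_zero hθ S)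
  refine tendsto_const_nhds.congr fun k => ?_
  simpa using lyapunov_iterate h0 k

theorem lyapunov_unique {θ S T M : Matrix (Fin n) (Fin n) ℝ} (hθ : θ ∈ stableSet n)
    (hS : S = θ * S * θᵀ + M) (hT : T = θ * T * θᵀ + M) : S = T := by
  refine sub_eq_zero.1 (eq_zero_of_eq_conj hθ ?_)
  nth_rw 1 [hS, hT]
  noncomm_ring

/-- The Lyapunov operator `S ↦ S - θ S θᵀ` is injective for stable `θ`, hence surjective. -/
theorem lyapunov_exists {θ : Matrix (Fin n) (Fin n) ℝ} (hθ : θ ∈ stableSet n)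
    (M : Matrix (Fin n) (Fin n) ℝ) : ∃ S, S = θ * S * θᵀ + M := by
  let L : Matrix (Fin n) (Fin n) ℝ →ₗ[ℝ] Matrix (Fin n) (Fin n) ℝ :=
    LinearMap.id - (LinearMap.mulRight ℝ θᵀ).comp (LinearMap.mulLeft ℝ θ)
  have hL : ∀ S, L S = S - θ * S * θᵀ := fun S => by simp [L]
  have hinj : Function.Injective L := by
    refine (injective_iff_map_eq_zero L).2 fun S hS => eq_zero_of_eq_conj hθ ?_
    rwa [hL, sub_eq_zero] at hS
  obtain ⟨S, hS⟩ := LinearMap.surjective_of_injective hinj M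
  refine ⟨S, ?_⟩
  rw [hL] at hS
  rw [← hS]; abel

theorem lyapunov_posSemidef {θ S M : Matrix (Fin n) (Fin n) ℝ} (hθ : θ ∈ stableSet n)
    (hS : S = θ * S * θᵀ + M) (hM : M.PosSemidef) : S.PosSemidef := by
  have h1 : Tendsto (fun k : ℕ => S - θ ^ k * S * (θ ^ k)ᵀ) atTop (𝓝 S) := by
    simpa using (tendsto_conj_zero hθ S).const_sub S
  refine isClosed_posSemidef.mem_of_tendsto h1 (Eventually.of_forall fun k => ?_)
  have : S - θ ^ k * S * (θ ^ k)ᵀ = ∑ j ∈ Finset.range k, θ ^ j * M * (θ ^ j)ᵀ := by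
    nth_rw 1 [lyapunov_iterate hS k]; abel
  simp only [Set.mem_ofPred_eq, this]
  exact posSemidef_sum _ fun j _ => hM.mul_mul_transpose _

theorem lyapunov_posDef {θ S M : Matrix (Fin n) (Fin n) ℝ} (hθ : θ ∈ stableSet n)
    (hS : S = θ * S * θᵀ + M) (hM : M.PosDef) : S.PosDef := by
  have := lyapunov_posSemidef hθ hS hM.posSemidef
  rw [hS]
  exact PosDef.posSemidef_add (this.mul_mul_transpose θ) hM

/-- Lyapunov's criterion. Iterating the equation bounds the sums `∑ tr (θ ^ j M (θ ^ j)ᵀ)` by `tr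
S`, so that the powers of `θ` tend to zero. -/
theorem mem_stableSet_of_lyapunov {θ S M : Matrix (Fin n) (Fin n) ℝ} (hSp : S.PosSemidef)
    (hS : S = θ * S * θᵀ + M) (hM : M.PosDef) : θ ∈ stableSet n := by
  rw [mem_stableSet_iff_tendsto]
  refine tendsto_zero_of_trace PosDef.one hM ?_
  simp only [Matrix.one_mul]
  refine Summable.tendsto_atTop_zero (summable_of_sum_range_le (c := trace S)
    (fun k => (hM.posSemidef.mul_mul_transpose _).trace_nonneg) fun k => ?_)
  have h1 := congrArg trace (lyapunov_iterate hS k)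
  rw [trace_add, trace_sum] at h1
  have h2 := (hSp.mul_mul_transpose (θ ^ k)).trace_nonneg
  linarith

end Lyapunov
end StableId

/-! ### The Riccati equation and the penalized problem -/

namespace StableId
open Filter Topology

section Riccati

variable {n : ℕ}

/-- The rate `½ tr (K⁻¹ (A - θ) S (A - θ)ᵀ)`, with the state covariance `S` as a free argument. -/
noncomputable def rateOf (K A θ S : Matrix (Fin n) (Fin n) ℝ) : ℝ :=
  1 / 2 * trace (K⁻¹ * (A - θ) * S * (A - θ)ᵀ)

/-- The closed-loop matrix `(1 + 2 K W)⁻¹ A` belonging to the matrix `W`. -/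
noncomputable def gain (K A W : Matrix (Fin n) (Fin n) ℝ) : Matrix (Fin n) (Fin n) ℝ :=
  (1 + (2 : ℝ) • (K * W))⁻¹ * A

/-- `W` is a positive definite solution of `W = M + Aᵀ W (1 + 2 K W)⁻¹ A`. The substitution
`W = δ P`, `M = δ Q` turns the Riccati equation with parameter `δ` into this one, in which `δ`
enters only through the additive term. -/
def IsRiccati (K A M W : Matrix (Fin n) (Fin n) ℝ) : Prop :=
  W.PosDef ∧ W = M + Aᵀ * W * gain K A W

variable {K A M W θ S : Matrix (Fin n) (Fin n) ℝ}

theorem _root_.Matrix.PosDef.transpose_eq (h : M.PosDef) : Mᵀ = M := by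
  simpa [IsHermitian] using h.1

theorem posDef_inv_add (hK : K.PosDef) (hW : W.PosSemidef) : ((1 / 2 : ℝ) • K⁻¹ + W).PosDef :=
  (hK.inv.smul (by norm_num)).add_posSemidef hW

theorem isUnit_one_add_smul_mul (hK : K.PosDef) (hW : W.PosSemidef) :
    IsUnit (1 + (2 : ℝ) • (K * W)) := by
  have h1 : (1 + (2 : ℝ) • (K * W)) = ((2 : ℝ) • K) * ((1 / 2 : ℝ) • K⁻¹ + W) := by
    rw [Matrix.mul_add, Matrix.smul_mul, Matrix.mul_smul, mul_nonsing_inv _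
      ((isUnit_iff_isUnit_det _).1 hK.isUnit)]
    simp [smul_smul]
  rw [h1]
  exact (hK.smul (by norm_num : (0 : ℝ) < 2)).isUnit.mul (posDef_inv_add hK hW).isUnit

theorem mul_gain (hK : K.PosDef) (hW : W.PosSemidef) :
    (1 + (2 : ℝ) • (K * W)) * gain K A W = A := by
  rw [gain, mul_nonsing_inv_cancel_left _ _
    ((isUnit_iff_isUnit_det _).1 (isUnit_one_add_smul_mul hK hW))]

theorem eq_gain_of_mul_eq (hK : K.PosDef) (hW : W.PosSemidef)
    (h : (1 + (2 : ℝ) • (K * W)) * θ = A) : θ = gain K A W := by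
  rw [gain, ← h, nonsing_inv_mul_cancel_left _ _
    ((isUnit_iff_isUnit_det _).1 (isUnit_one_add_smul_mul hK hW))]

/-- Completion of the square: with `R = ½ K⁻¹`, the quadratic
`(A - θ)ᵀ R (A - θ) + θᵀ W θ` in `θ` is minimal at `γ = (1 + 2 K W)⁻¹ A`. -/
theorem complete_square {γ : Matrix (Fin n) (Fin n) ℝ} (hK : K.PosDef) (hW : Wᵀ = W)
    (hγ : (1 + (2 : ℝ) • (K * W)) * γ = A) (θ : Matrix (Fin n) (Fin n) ℝ) :
    (A - θ)ᵀ * ((1 / 2 : ℝ) • K⁻¹) * (A - θ) + θᵀ * W * θ =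
      Aᵀ * W * γ + (θ - γ)ᵀ * ((1 / 2 : ℝ) • K⁻¹ + W) * (θ - γ) := by
  set R : Matrix (Fin n) (Fin n) ℝ := (1 / 2 : ℝ) • K⁻¹ with hR
  have hRT : Rᵀ = R := by
    rw [hR, transpose_smul, hK.inv.transpose_eq]
  have hRA : (R + W) * γ = R * A := by
    rw [← hγ, ← Matrix.mul_assoc]
    congr 1
    rw [Matrix.mul_add, Matrix.mul_one, hR, Matrix.smul_mul, Matrix.mul_smul,
      nonsing_inv_mul_cancel_left _ _ ((isUnit_iff_isUnit_det _).1 hK.isUnit)]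
    simp [smul_smul]
  have hRA' : γᵀ * (R + W) = Aᵀ * R := by
    have := congrArg transpose hRA
    simpa [transpose_mul, hRT, hW] using this
  have e1 : (θ - γ)ᵀ * (R + W) * (θ - γ) =
      θᵀ * (R + W) * θ - θᵀ * ((R + W) * γ) - γᵀ * (R + W) * θ + γᵀ * (R + W) * γ := by
    rw [transpose_sub]; noncomm_ring
  have e2 : Aᵀ * W * γ = Aᵀ * R * A - Aᵀ * R * γ := by
    have : Aᵀ * ((R + W) * γ) = Aᵀ * (R * A) := by rw [hRA]
    rw [Matrix.mul_assoc Aᵀ R A, ← this]; noncomm_ring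
  rw [e1, hRA, hRA', e2, transpose_sub]
  noncomm_ring

theorem trace_conj (N X S : Matrix (Fin n) (Fin n) ℝ) :
    trace (Xᵀ * N * X * S) = trace (N * (X * S * Xᵀ)) := by
  rw [Matrix.mul_assoc, Matrix.mul_assoc, trace_mul_comm]
  simp only [Matrix.mul_assoc]

theorem rateOf_eq (K A θ S : Matrix (Fin n) (Fin n) ℝ) :
    rateOf K A θ S = trace ((A - θ)ᵀ * ((1 / 2 : ℝ) • K⁻¹) * (A - θ) * S) := by
  rw [trace_conj, rateOf]
  simp [Matrix.mul_assoc]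

theorem rateOf_nonneg (hK : K.PosDef) (hS : S.PosSemidef) (A θ : Matrix (Fin n) (Fin n) ℝ) :
    0 ≤ rateOf K A θ S := by
  rw [rateOf_eq, trace_conj]
  exact (hK.inv.smul (by norm_num : (0 : ℝ) < 1 / 2)).posSemidef.trace_mul_nonneg
    (hS.mul_mul_transpose _)

/-- Duality of the Lyapunov equations for `θ` and `θᵀ`. -/
theorem lyapunov_trace_dual {P N : Matrix (Fin n) (Fin n) ℝ} (hP : P = θᵀ * P * θ + N)
    (hS : S = θ * S * θᵀ + K) : trace (N * S) = trace (P * K) := by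
  have hN : N = P - θᵀ * P * θ := by nth_rw 1 [hP]; abel
  have hK : K = S - θ * S * θᵀ := by nth_rw 1 [hS]; abel
  rw [hN, hK, Matrix.sub_mul, Matrix.mul_sub, trace_sub, trace_sub, trace_conj]

/-- The cost `tr (M S) + rateOf K A θ S` equals the optimal value `tr (W K)` plus a gap that is
positive definite in `θ - γ`. -/
theorem cost_eq {γ : Matrix (Fin n) (Fin n) ℝ} (hK : K.PosDef) (hW : Wᵀ = W)
    (hγ : (1 + (2 : ℝ) • (K * W)) * γ = A) (hric : W = M + Aᵀ * W * γ)
    (hS : S = θ * S * θᵀ + K) :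
    trace (M * S) + rateOf K A θ S =
      trace (W * K) + trace (((1 / 2 : ℝ) • K⁻¹ + W) * ((θ - γ) * S * (θ - γ)ᵀ)) := by
  have h1 := congrArg (fun X => trace (X * S)) (complete_square hK hW hγ θ)
  simp only [Matrix.add_mul _ _ S, trace_add] at h1
  rw [← rateOf_eq, trace_conj W, trace_conj ((1 / 2 : ℝ) • K⁻¹ + W)] at h1
  have h2 := congrArg (fun X => trace (X * S)) hric
  simp only [Matrix.add_mul, trace_add] at h2
  have h3 := congrArg (fun X => trace (W * X)) hS
  simp only [Matrix.mul_add, trace_add] at h3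
  linarith

/-- A Riccati solution solves the Lyapunov equation of its own closed loop, with the stage cost as
right-hand side. -/
theorem riccati_lyapunov (hK : K.PosDef) (hW : IsRiccati K A M W) :
    W = (gain K A W)ᵀ * W * gain K A W +
      (M + (A - gain K A W)ᵀ * ((1 / 2 : ℝ) • K⁻¹) * (A - gain K A W)) := by
  have h := complete_square hK hW.1.transpose_eq (mul_gain (A := A) hK hW.1.posSemidef) (gain K A W)
  simp only [sub_self, transpose_zero, Matrix.zero_mul, add_zero] at h
  nth_rw 1 [hW.2]
  rw [← h]
  abel

theorem posDef_stageCost (hK : K.PosDef) (hM : M.PosDef) (θ : Matrix (Fin n) (Fin n) ℝ) :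
    (M + (A - θ)ᵀ * ((1 / 2 : ℝ) • K⁻¹) * (A - θ)).PosDef := by
  refine hM.add_posSemidef ?_
  simpa using (hK.inv.smul (by norm_num : (0 : ℝ) < 1 / 2)).posSemidef.mul_mul_transpose (A - θ)ᵀ

theorem gain_mem_stableSet (hK : K.PosDef) (hM : M.PosDef) (hW : IsRiccati K A M W) :
    gain K A W ∈ stableSet n := by
  have h := mem_stableSet_of_lyapunov (θ := (gain K A W)ᵀ) hW.1.posSemidef
    (by simpa using riccati_lyapunov hK hW) (posDef_stageCost hK hM _)
  simpa using transpose_mem_stableSet h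

theorem cost_ge (hK : K.PosDef) (hW : IsRiccati K A M W) (hSp : S.PosSemidef)
    (hS : S = θ * S * θᵀ + K) : trace (W * K) ≤ trace (M * S) + rateOf K A θ S := by
  rw [cost_eq hK hW.1.transpose_eq (mul_gain hK hW.1.posSemidef) hW.2 hS]
  have := (posDef_inv_add hK hW.1.posSemidef).posSemidef.trace_mul_nonneg
    (hSp.mul_mul_transpose (θ - gain K A W))
  linarith

theorem eq_gain_of_cost_le (hK : K.PosDef) (hW : IsRiccati K A M W) (hSp : S.PosDef)
    (hS : S = θ * S * θᵀ + K) (hle : trace (M * S) + rateOf K A θ S ≤ trace (W * K)) :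
    θ = gain K A W := by
  rw [cost_eq hK hW.1.transpose_eq (mul_gain hK hW.1.posSemidef) hW.2 hS] at hle
  by_contra hne
  have := trace_mul_conj_pos (posDef_inv_add hK hW.1.posSemidef) hSp (sub_ne_zero.2 hne)
  linarith

theorem cost_gain (hK : K.PosDef) (hW : IsRiccati K A M W)
    (hS : S = gain K A W * S * (gain K A W)ᵀ + K) :
    trace (M * S) + rateOf K A (gain K A W) S = trace (W * K) := by
  rw [cost_eq hK hW.1.transpose_eq (mul_gain hK hW.1.posSemidef) hW.2 hS]
  simp

/-- Both solutions have the unique minimizer of the cost as their closed loop, and then solve the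
same Lyapunov equation. -/
theorem riccati_unique (hK : K.PosDef) (hM : M.PosDef) {V : Matrix (Fin n) (Fin n) ℝ}
    (hW : IsRiccati K A M W) (hV : IsRiccati K A M V) : W = V := by
  have hw := gain_mem_stableSet hK hM hW
  have hv := gain_mem_stableSet hK hM hV
  obtain ⟨S, hS⟩ := lyapunov_exists hw K
  obtain ⟨T, hT⟩ := lyapunov_exists hv K
  have hSp := lyapunov_posDef hw hS hK
  have hTp := lyapunov_posDef hv hT hK
  have h1 := cost_gain hK hW hS
  have h2 := cost_gain hK hV hT
  have h3 := cost_ge hK hW hTp.posSemidef hT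
  have hg : gain K A W = gain K A V := eq_gain_of_cost_le hK hV hSp hS (by linarith)
  have hw' := riccati_lyapunov hK hW
  have hv' := riccati_lyapunov hK hV
  rw [← hg] at hv'
  exact lyapunov_unique (transpose_mem_stableSet hw) (by simpa using hw') (by simpa using hv')

theorem abs_apply_le_trace (hS : S.PosSemidef) (i j : Fin n) : |S i j| ≤ trace S := by
  obtain ⟨B, rfl⟩ : ∃ B : Matrix (Fin n) (Fin n) ℝ, S = Bᴴ * B := by
    open scoped MatrixOrder in
    exact CStarAlgebra.nonneg_iff_eq_star_mul_self.1 hS.nonneg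
  have hd : ∀ i, (Bᴴ * B) i i ≤ trace (Bᴴ * B) := fun i =>
    Finset.single_le_sum (f := fun i => (Bᴴ * B) i i) (fun _ _ => hS.diag_nonneg)
      (Finset.mem_univ i)
  have h1 := hd i
  have h2 := hd j
  refine abs_le.2 ⟨?_, ?_⟩
  · have : 0 ≤ (Bᴴ * B) i i + (Bᴴ * B) j j + 2 * (Bᴴ * B) i j := by
      simp only [Matrix.mul_apply, conjTranspose_apply, star_trivial, Finset.mul_sum,
        ← Finset.sum_add_distrib]
      exact Finset.sum_nonneg fun k _ => by nlinarith [sq_nonneg (B k i + B k j)]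
    linarith
  · have : 0 ≤ (Bᴴ * B) i i + (Bᴴ * B) j j - 2 * (Bᴴ * B) i j := by
      simp only [Matrix.mul_apply, conjTranspose_apply, star_trivial, Finset.mul_sum,
        ← Finset.sum_add_distrib, ← Finset.sum_sub_distrib]
      exact Finset.sum_nonneg fun k _ => by nlinarith [sq_nonneg (B k i - B k j)]
    linarith

/-- The cost has a minimizer over the pairs `(θ, S)` with `S = θ S θᵀ + K`. These pairs form a
closed set, on which `θ` is stable automatically, and the cost is coercive on it. -/
theorem exists_cost_minimizer (hK : K.PosDef) (hM : M.PosDef) (A : Matrix (Fin n) (Fin n) ℝ) :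
    ∃ θ S : Matrix (Fin n) (Fin n) ℝ, S.PosSemidef ∧ S = θ * S * θᵀ + K ∧
      ∀ η T : Matrix (Fin n) (Fin n) ℝ, T.PosSemidef → T = η * T * ηᵀ + K →
        trace (M * S) + rateOf K A θ S ≤ trace (M * T) + rateOf K A η T := by
  let F : Matrix (Fin n) (Fin n) ℝ × Matrix (Fin n) (Fin n) ℝ → ℝ := fun p =>
    trace (M * p.2) + rateOf K A p.1 p.2
  have hF : Continuous F := by unfold F rateOf; fun_prop
  let C : Set (Matrix (Fin n) (Fin n) ℝ × Matrix (Fin n) (Fin n) ℝ) :=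
    {p | p.2.PosSemidef ∧ p.2 = p.1 * p.2 * p.1ᵀ + K}
  have hC : IsClosed C := (isClosed_posSemidef.preimage continuous_snd).inter
    (isClosed_eq continuous_snd (by fun_prop))
  have h0 : ((0 : Matrix (Fin n) (Fin n) ℝ), K) ∈ C := ⟨hK.posSemidef, by simp⟩
  let c := F (0, K)
  -- `a` bounds `S` and `b` bounds `θ` on the sublevel set, the latter because `θ K θᵀ ≤ S`
  obtain ⟨a, ha, hMa⟩ := hM.exists_posSemidef_sub_smul_one
  obtain ⟨b, hb, hMb⟩ := exists_le_trace_mul hM hK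
  let box : ℝ → Set (Matrix (Fin n) (Fin n) ℝ) := fun r =>
    Set.pi Set.univ fun _ => Set.pi Set.univ fun _ => Set.Icc (-r) r
  have hbox : ∀ r, IsCompact (box r) := fun r =>
    isCompact_univ_pi fun _ => isCompact_univ_pi fun _ => isCompact_Icc
  have hsub : C ∩ {p | F p ≤ c} ⊆ box (√(c / b)) ×ˢ box (c / a) := by
    rintro ⟨θ, S⟩ ⟨⟨hSp, hS⟩, hFc⟩
    simp only at hSp hS
    have hI := rateOf_nonneg hK hSp A θ
    have hMS : trace (M * S) ≤ c := by
      change trace (M * S) + rateOf K A θ S ≤ c at hFc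
      linarith
    constructor
    · intro i _ j _
      refine abs_le.1 (Real.abs_le_sqrt ?_)
      rw [le_div_iff₀ hb]
      have h1 : trace (M * (θ * K * θᵀ)) ≤ trace (M * S) := by
        have hd : S - θ * K * θᵀ = θ * (θ * S * θᵀ) * θᵀ + K := by
          nth_rw 1 [hS]; nth_rw 1 [hS]; noncomm_ring
        have := hM.posSemidef.trace_mul_nonneg (N := S - θ * K * θᵀ) (by
          rw [hd]; exact ((hSp.mul_mul_transpose θ).mul_mul_transpose θ).add hK.posSemidef)
        rw [Matrix.mul_sub, trace_sub] at this
        linarith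
      nlinarith [hMb θ, sq_apply_le_trace θ i j]
    · intro i _ j _
      refine abs_le.1 ((abs_apply_le_trace hSp i j).trans ?_)
      rw [le_div_iff₀ ha]
      have := hMa.trace_mul_nonneg hSp
      rw [Matrix.sub_mul, trace_sub, Matrix.smul_mul, trace_smul, Matrix.one_mul,
        smul_eq_mul] at this
      linarith
  have hcomp : IsCompact (C ∩ {p | F p ≤ c}) :=
    ((hbox _).prod (hbox _)).of_isClosed_subset
      (hC.inter (isClosed_le hF continuous_const)) hsub
  obtain ⟨⟨θ, S⟩, ⟨⟨hSp, hS⟩, hc⟩, hmin⟩ := hcomp.exists_isMinOn ⟨_, h0, le_refl c⟩ hF.continuousOn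
  refine ⟨θ, S, hSp, hS, fun η T hTp hT => ?_⟩
  by_cases hle : F (η, T) ≤ c
  · exact hmin (show (η, T) ∈ C ∩ {p | F p ≤ c} from ⟨⟨hTp, hT⟩, hle⟩)
  · exact (show F (θ, S) ≤ c from hc).trans (not_le.1 hle).le

/-- The matrix `P` that evaluates the cost of a minimizer `θ` solves the Riccati equation: otherwise
the closed loop of `P` would be stable and strictly cheaper than `θ`. -/
theorem riccati_exists (hK : K.PosDef) (hM : M.PosDef) (A : Matrix (Fin n) (Fin n) ℝ) :
    ∃ W, IsRiccati K A M W := by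
  obtain ⟨θ, S, hSp, hS, hmin⟩ := exists_cost_minimizer hK hM A
  have hθ := mem_stableSet_of_lyapunov hSp hS hK
  obtain ⟨P, hP⟩ := lyapunov_exists (transpose_mem_stableSet hθ)
    (M + (A - θ)ᵀ * ((1 / 2 : ℝ) • K⁻¹) * (A - θ))
  have hPp := lyapunov_posDef (transpose_mem_stableSet hθ) hP (posDef_stageCost hK hM θ)
  rw [transpose_transpose] at hP
  have hcost := lyapunov_trace_dual hP hS
  rw [Matrix.add_mul, trace_add, ← rateOf_eq] at hcost
  set γ := gain K A P with hγdef
  have hγ : (1 + (2 : ℝ) • (K * P)) * γ = A := mul_gain hK hPp.posSemidef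
  have h1 := complete_square hK hPp.transpose_eq hγ θ
  have h2 := complete_square hK hPp.transpose_eq hγ γ
  simp only [sub_self, transpose_zero, Matrix.zero_mul, add_zero] at h2
  have hG := posDef_inv_add hK hPp.posSemidef
  -- One step of policy improvement: `P` is a Lyapunov solution for `γ` as well, with the stage cost
  -- of `γ` increased by the square of `θ - γ`.
  have h3 : P = M + Aᵀ * P * γ + (θ - γ)ᵀ * ((1 / 2 : ℝ) • K⁻¹ + P) * (θ - γ) := by
    rw [add_assoc, ← h1]
    nth_rw 1 [hP]; abel
  have h4 : P = γᵀ * P * γ + (M + (A - γ)ᵀ * ((1 / 2 : ℝ) • K⁻¹) * (A - γ) +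
      (θ - γ)ᵀ * ((1 / 2 : ℝ) • K⁻¹ + P) * (θ - γ)) := by
    nth_rw 1 [h3]
    rw [← h2]; abel
  have hpsd : ((θ - γ)ᵀ * ((1 / 2 : ℝ) • K⁻¹ + P) * (θ - γ)).PosSemidef := by
    simpa using hG.posSemidef.mul_mul_transpose (θ - γ)ᵀ
  have hγs : γ ∈ stableSet n := by
    have := mem_stableSet_of_lyapunov (θ := γᵀ) hPp.posSemidef (by simpa using h4)
      ((posDef_stageCost hK hM γ).add_posSemidef hpsd)
    simpa using transpose_mem_stableSet this
  obtain ⟨T, hT⟩ := lyapunov_exists hγs K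
  have hTp := lyapunov_posDef hγs hT hK
  have hcost' := lyapunov_trace_dual h4 hT
  rw [Matrix.add_mul, trace_add, Matrix.add_mul, trace_add, ← rateOf_eq, trace_conj] at hcost'
  have hle := hmin γ T hTp.posSemidef hT
  have hθγ : θ = γ := by
    by_contra hne
    have := trace_mul_conj_pos hG hTp (sub_ne_zero.2 hne)
    linarith
  refine ⟨P, hPp, ?_⟩
  nth_rw 1 [h3]
  simp [hθγ, ← hγdef]

end Riccati
end StableId

/-! ### Analytic dependence of the Riccati solution on the penalty -/

namespace StableId
open Filter Topology
open scoped ContDiff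

section Path

attribute [local instance] Matrix.linftyOpNormedRing Matrix.linftyOpNormedAlgebra

variable {n : ℕ} {K Q A M W θ : Matrix (Fin n) (Fin n) ℝ}

/-- A solution of the polynomial form of the Riccati equation with stable closed loop `θ` is
symmetric and positive definite, although neither is assumed. -/
theorem isRiccati_of_stable (hK : K.PosDef) (hM : M.PosDef) (hθ : θ ∈ stableSet n)
    (h1 : (1 + (2 : ℝ) • (K * W)) * θ = A) (h2 : W - Aᵀ * W * θ = M) :
    IsRiccati K A M W := by
  have hA : Aᵀ = θᵀ * (1 + (2 : ℝ) • (Wᵀ * K)) := by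
    rw [← h1, transpose_mul, transpose_add, transpose_smul, transpose_mul, hK.transpose_eq,
      transpose_one]
  have hW : W = θᵀ * W * θᵀᵀ + (M + (2 : ℝ) • ((W * θ)ᵀ * K * (W * θ))) := by
    have : W = M + Aᵀ * W * θ := by rw [← h2]; abel
    nth_rw 1 [this, hA]
    simp only [Matrix.mul_add, Matrix.add_mul, Matrix.mul_one, Matrix.mul_smul, Matrix.smul_mul,
      transpose_mul, Matrix.mul_assoc, transpose_transpose]
    abel
  have hWp : W.PosDef := by
    refine lyapunov_posDef (transpose_mem_stableSet hθ) hW (hM.add_posSemidef ?_)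
    refine PosSemidef.smul ?_ (by norm_num : (0 : ℝ) ≤ 2)
    simpa using hK.posSemidef.mul_mul_transpose (W * θ)ᵀ
  refine ⟨hWp, ?_⟩
  rw [← eq_gain_of_mul_eq hK hWp.posSemidef h1, ← h2]
  abel

/-- The polynomial form of the Riccati equation in the pair `(W, θ)`: the equation with closed loop
`θ` reads `riccatiMap K A (W, θ) = (A, M)`. -/
noncomputable def riccatiMap (K A : Matrix (Fin n) (Fin n) ℝ)
    (p : Matrix (Fin n) (Fin n) ℝ × Matrix (Fin n) (Fin n) ℝ) :
    Matrix (Fin n) (Fin n) ℝ × Matrix (Fin n) (Fin n) ℝ :=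
  ((1 + (2 : ℝ) • (K * p.1)) * p.2, p.1 - Aᵀ * p.1 * p.2)

/-- The derivative of `riccatiMap` at a stabilizing solution is invertible: an element `(H, η)` of
its kernel satisfies the homogeneous Lyapunov equation `H = θᵀ H θ`, which forces `H = 0` and `η =
0`. -/
theorem exists_hasFDerivAt_riccatiMap (hK : K.PosDef) (hW : W.PosDef) (hθ : θ ∈ stableSet n)
    (h1 : (1 + (2 : ℝ) • (K * W)) * θ = A) :
    ∃ D : (Matrix (Fin n) (Fin n) ℝ × Matrix (Fin n) (Fin n) ℝ) ≃L[ℝ]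
      (Matrix (Fin n) (Fin n) ℝ × Matrix (Fin n) (Fin n) ℝ),
      HasFDerivAt (riccatiMap K A)
        (D : (Matrix (Fin n) (Fin n) ℝ × Matrix (Fin n) (Fin n) ℝ) →L[ℝ] _) (W, θ) := by
  have hf : HasFDerivAt (fun p : Matrix (Fin n) (Fin n) ℝ × Matrix (Fin n) (Fin n) ℝ => p.1)
    (ContinuousLinearMap.fst ℝ _ _) (W, θ) := hasFDerivAt_fst
  have hs : HasFDerivAt (fun p : Matrix (Fin n) (Fin n) ℝ × Matrix (Fin n) (Fin n) ℝ => p.2)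
    (ContinuousLinearMap.snd ℝ _ _) (W, θ) := hasFDerivAt_snd
  have hd := (((hf.const_mul K).const_smul (2 : ℝ)).const_add 1 |>.mul' hs).prodMk
    (hf.sub ((hf.const_mul Aᵀ).mul' hs))
  obtain ⟨D, hD, hDv⟩ : ∃ D : (Matrix (Fin n) (Fin n) ℝ × Matrix (Fin n) (Fin n) ℝ) →L[ℝ]
      (Matrix (Fin n) (Fin n) ℝ × Matrix (Fin n) (Fin n) ℝ),
      HasFDerivAt (riccatiMap K A) D (W, θ) ∧ ∀ H η, D (H, η) =
        ((1 + (2 : ℝ) • (K * W)) * η + (2 : ℝ) • (K * H) * θ,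
          H - (Aᵀ * W * η + Aᵀ * H * θ)) :=
    ⟨_, hd, fun H η => rfl⟩
  have hinj : Function.Injective D.toLinearMap := by
    refine (injective_iff_map_eq_zero _).2 ?_
    rintro ⟨H, η⟩ h0
    simp only [ContinuousLinearMap.coe_coe, hDv, Prod.mk_eq_zero] at h0
    obtain ⟨e1, e2⟩ := h0
    have e1' : (1 + (2 : ℝ) • (K * W)) * η = -((2 : ℝ) • (K * H) * θ) :=
      eq_neg_of_add_eq_zero_left e1
    have hA : Aᵀ = θᵀ * (1 + (2 : ℝ) • (W * K)) := by
      rw [← h1, transpose_mul, transpose_add, transpose_smul, transpose_mul, hK.transpose_eq,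
        transpose_one, hW.transpose_eq]
    have hcomm : (1 + (2 : ℝ) • (W * K)) * W = W * (1 + (2 : ℝ) • (K * W)) := by
      simp [Matrix.add_mul, Matrix.mul_add, Matrix.mul_assoc]
    have e3 : Aᵀ * W * η = -(θᵀ * W * ((2 : ℝ) • (K * H) * θ)) := by
      rw [hA, Matrix.mul_assoc θᵀ, hcomm, ← Matrix.mul_assoc, Matrix.mul_assoc (θᵀ * W), e1',
        Matrix.mul_neg]
    have hH : H = 0 := by
      refine eq_zero_of_eq_conj (transpose_mem_stableSet hθ) ?_
      rw [sub_eq_zero, e3, hA] at e2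
      nth_rw 1 [e2]
      simp only [transpose_transpose, Matrix.mul_add, Matrix.add_mul, Matrix.mul_one,
        Matrix.mul_smul, Matrix.smul_mul, Matrix.mul_assoc]
      abel
    subst hH
    simp only [Matrix.mul_zero, Matrix.zero_mul, smul_zero, add_zero] at e1
    rw [(isUnit_one_add_smul_mul hK hW.posSemidef).mul_right_eq_zero.1 e1]
    rfl
  exact ⟨(LinearEquiv.ofInjectiveEndo D.toLinearMap hinj).toContinuousLinearEquiv, hD⟩

theorem contDiffAt_riccatiMap (p : Matrix (Fin n) (Fin n) ℝ × Matrix (Fin n) (Fin n) ℝ) :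
    ContDiffAt ℝ ω (riccatiMap K A) p := by
  unfold riccatiMap
  have h1 : ContDiff ℝ ω fun p : Matrix (Fin n) (Fin n) ℝ × Matrix (Fin n) (Fin n) ℝ => p.1 :=
    contDiff_fst
  have h2 : ContDiff ℝ ω fun p : Matrix (Fin n) (Fin n) ℝ × Matrix (Fin n) (Fin n) ℝ => p.2 :=
    contDiff_snd
  exact (((contDiff_const.add ((contDiff_const.mul h1).const_smul (2 : ℝ))).mul h2).prodMk
    (h1.sub ((contDiff_const.mul h1).mul h2))).contDiffAt

/-- Near `δ₀` the local inverse of `riccatiMap` gives a pair with stable closed loop, because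
stability is open, and this pair is the Riccati solution by uniqueness. -/
theorem riccati_analyticAt (hK : K.PosDef) (hQ : Q.PosDef) {W : ℝ → Matrix (Fin n) (Fin n) ℝ}
    (hW : ∀ δ, 0 < δ → IsRiccati K A (δ • Q) (W δ)) {δ₀ : ℝ} (hδ₀ : 0 < δ₀) :
    AnalyticAt ℝ (fun δ => (W δ, gain K A (W δ))) δ₀ := by
  have hW₀ := hW δ₀ hδ₀
  have hst := gain_mem_stableSet hK (hQ.smul hδ₀) hW₀
  obtain ⟨D, hD⟩ := exists_hasFDerivAt_riccatiMap hK hW₀.1 hst (mul_gain hK hW₀.1.posSemidef)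
  have hG := contDiffAt_riccatiMap (K := K) (A := A) (W δ₀, gain K A (W δ₀))
  have hω : (ω : WithTop ℕ∞) ≠ 0 := by simp
  set ψ := hG.localInverse hD hω
  have hψc : ContDiffAt ℝ ω ψ (riccatiMap K A (W δ₀, gain K A (W δ₀))) :=
    hG.to_localInverse hD hω
  have hψ₀ : ψ (riccatiMap K A (W δ₀, gain K A (W δ₀))) = (W δ₀, gain K A (W δ₀)) :=
    hG.localInverse_apply_image hD hω
  have hright : ∀ᶠ y in 𝓝 (riccatiMap K A (W δ₀, gain K A (W δ₀))),
      riccatiMap K A (ψ y) = y :=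
    (hG.hasStrictFDerivAt' hD hω).eventually_right_inverse
  have hval : riccatiMap K A (W δ₀, gain K A (W δ₀)) = (A, δ₀ • Q) := by
    simp only [riccatiMap, mul_gain hK hW₀.1.posSemidef, Prod.mk.injEq, true_and]
    rw [sub_eq_iff_eq_add]
    exact hW₀.2
  rw [hval] at hψc hψ₀ hright
  let ℓ : ℝ → Matrix (Fin n) (Fin n) ℝ × Matrix (Fin n) (Fin n) ℝ := fun δ => (A, δ • Q)
  have hℓ : ContDiff ℝ ω ℓ := contDiff_const.prodMk (contDiff_id.smul contDiff_const)
  have hcomp : ContDiffAt ℝ ω (ψ ∘ ℓ) δ₀ := ContDiffAt.comp δ₀ hψc hℓ.contDiffAt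
  refine hcomp.analyticAt.congr ?_
  have e1 : ∀ᶠ δ in 𝓝 δ₀, riccatiMap K A (ψ (ℓ δ)) = ℓ δ :=
    hℓ.continuous.continuousAt.eventually hright
  have e2 : ∀ᶠ δ in 𝓝 δ₀, (ψ (ℓ δ)).2 ∈ stableSet n := by
    have hc : ContinuousAt (fun δ => (ψ (ℓ δ)).2) δ₀ := continuous_snd.continuousAt.comp
      hcomp.continuousAt
    refine hc.eventually (isOpen_stableSet.mem_nhds ?_)
    change (ψ (A, δ₀ • Q)).2 ∈ stableSet n
    rw [hψ₀]; exact hst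
  filter_upwards [e1, e2, lt_mem_nhds hδ₀] with δ h1 h2 h3
  simp only [riccatiMap, ℓ, Prod.mk.injEq] at h1
  have hR := isRiccati_of_stable hK (hQ.smul h3) h2 h1.1 h1.2
  have hWeq : (ψ (ℓ δ)).1 = W δ := riccati_unique hK (hQ.smul h3) hR (hW δ h3)
  refine Prod.ext hWeq ?_
  rw [← hWeq]
  exact eq_gain_of_mul_eq hK hR.1.posSemidef h1.1

end Path
end StableId

/-! ### The rate along the family of optimal closed loops -/

namespace StableId
open Filter Topology
open scoped ContDiff

section Rate

attribute [local instance] Matrix.linftyOpNormedRing Matrix.linftyOpNormedAlgebra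

variable {n : ℕ}

/-- The data of the parametric problem: `C` assigns to each stable `θ` its state covariance, and
`W δ` is the scaled Riccati solution for `δ > 0` (arbitrary for other `δ`). -/
structure IsRiccatiPath (K Q A : Matrix (Fin n) (Fin n) ℝ)
    (C : Matrix (Fin n) (Fin n) ℝ → Matrix (Fin n) (Fin n) ℝ) (W : ℝ → Matrix (Fin n) (Fin n) ℝ) :
    Prop where
  posDef_K : K.PosDef
  posDef_Q : Q.PosDef
  ne_zero : A ≠ 0
  lyapunov : ∀ θ ∈ stableSet n, C θ = θ * C θ * θᵀ + K
  riccati : ∀ δ, 0 < δ → IsRiccati K A (δ • Q) (W δ)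

namespace IsRiccatiPath

variable {K Q A : Matrix (Fin n) (Fin n) ℝ}
  {C : Matrix (Fin n) (Fin n) ℝ → Matrix (Fin n) (Fin n) ℝ} {W : ℝ → Matrix (Fin n) (Fin n) ℝ}
  {δ δ₀ r : ℝ} {θ : Matrix (Fin n) (Fin n) ℝ}

theorem stable (h : IsRiccatiPath K Q A C W) (hδ : 0 < δ) : gain K A (W δ) ∈ stableSet n :=
  gain_mem_stableSet h.posDef_K (h.posDef_Q.smul hδ) (h.riccati δ hδ)

theorem posDef_cov (h : IsRiccatiPath K Q A C W) (hθ : θ ∈ stableSet n) : (C θ).PosDef :=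
  lyapunov_posDef hθ (h.lyapunov θ hθ) h.posDef_K

theorem cost_nonneg (h : IsRiccatiPath K Q A C W) (hθ : θ ∈ stableSet n) :
    0 ≤ trace (Q * C θ) :=
  h.posDef_Q.posSemidef.trace_mul_nonneg (h.posDef_cov hθ).posSemidef

theorem rate_nonneg (h : IsRiccatiPath K Q A C W) (hθ : θ ∈ stableSet n) :
    0 ≤ rateOf K A θ (C θ) :=
  rateOf_nonneg h.posDef_K (h.posDef_cov hθ).posSemidef A θ

theorem cov_zero (h : IsRiccatiPath K Q A C W) : C 0 = K := by
  simpa using h.lyapunov 0 zero_mem_stableSet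

theorem value_eq (h : IsRiccatiPath K Q A C W) (hδ : 0 < δ) :
    trace (W δ * K) = δ * trace (Q * C (gain K A (W δ))) +
      rateOf K A (gain K A (W δ)) (C (gain K A (W δ))) := by
  have := cost_gain h.posDef_K (h.riccati δ hδ) (h.lyapunov _ (h.stable hδ))
  simpa using this.symm

theorem gap_eq (h : IsRiccatiPath K Q A C W) (hδ : 0 < δ) (hθ : θ ∈ stableSet n) :
    δ * trace (Q * C θ) + rateOf K A θ (C θ) = trace (W δ * K) +
      trace (((1 / 2 : ℝ) • K⁻¹ + W δ) *
        ((θ - gain K A (W δ)) * C θ * (θ - gain K A (W δ))ᵀ)) := by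
  have hr := h.riccati δ hδ
  have := cost_eq h.posDef_K hr.1.transpose_eq (mul_gain h.posDef_K hr.1.posSemidef) hr.2
    (h.lyapunov θ hθ)
  simpa using this

theorem value_le (h : IsRiccatiPath K Q A C W) (hδ : 0 < δ) (hθ : θ ∈ stableSet n) :
    trace (W δ * K) ≤ δ * trace (Q * C θ) + rateOf K A θ (C θ) := by
  simpa using cost_ge h.posDef_K (h.riccati δ hδ) (h.posDef_cov hθ).posSemidef (h.lyapunov θ hθ)

theorem eq_gain_of_le (h : IsRiccatiPath K Q A C W) (hδ : 0 < δ) (hθ : θ ∈ stableSet n)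
    (hc : trace (Q * C θ) ≤ trace (Q * C (gain K A (W δ))))
    (hr : rateOf K A θ (C θ) ≤ rateOf K A (gain K A (W δ)) (C (gain K A (W δ)))) :
    θ = gain K A (W δ) := by
  refine eq_gain_of_cost_le h.posDef_K (h.riccati δ hδ) (h.posDef_cov hθ) (h.lyapunov θ hθ) ?_
  rw [h.value_eq hδ, Matrix.smul_mul, trace_smul, smul_eq_mul]
  gcongr

theorem gain_ne_zero (h : IsRiccatiPath K Q A C W) (hδ : 0 < δ) : gain K A (W δ) ≠ 0 := by
  intro h0
  have := mul_gain (A := A) h.posDef_K (h.riccati δ hδ).1.posSemidef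
  rw [h0, Matrix.mul_zero] at this
  exact h.ne_zero this.symm

theorem analyticAt_value (h : IsRiccatiPath K Q A C W) (hδ : 0 < δ) :
    AnalyticAt ℝ (fun δ => trace (W δ * K)) δ := by
  have h1 : AnalyticAt ℝ W δ :=
    analyticAt_fst.comp (riccati_analyticAt h.posDef_K h.posDef_Q h.riccati hδ)
  let L : Matrix (Fin n) (Fin n) ℝ →ₗ[ℝ] ℝ :=
    (traceLinearMap (Fin n) ℝ ℝ).comp (LinearMap.mulRight ℝ K)
  exact (L.toContinuousLinearMap.analyticAt _).comp h1

theorem analyticAt_gain (h : IsRiccatiPath K Q A C W) (hδ : 0 < δ) :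
    AnalyticAt ℝ (fun δ => gain K A (W δ)) δ :=
  analyticAt_snd.comp (riccati_analyticAt h.posDef_K h.posDef_Q h.riccati hδ)

/-- Envelope theorem: the value is a minimum of functions affine in `δ`, whose slope at the
minimizer is the state cost. -/
theorem hasDerivAt_value (h : IsRiccatiPath K Q A C W) (hδ : 0 < δ) :
    HasDerivAt (fun δ => trace (W δ * K)) (trace (Q * C (gain K A (W δ)))) δ := by
  set c := trace (Q * C (gain K A (W δ)))
  have hd := (h.analyticAt_value hδ).differentiableAt.hasDerivAt
  have hd2 := hd.sub ((hasDerivAt_id δ).mul_const c)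
  have hmax : IsLocalMax ((fun δ => trace (W δ * K)) - fun t => id t * c) δ := by
    filter_upwards [lt_mem_nhds hδ] with t ht
    have h1 := h.value_le ht (h.stable hδ)
    have h2 := h.value_eq hδ
    simp only [Pi.sub_apply, id]
    linarith
  have := hmax.hasDerivAt_eq_zero hd2
  rw [one_mul, sub_eq_zero] at this
  rwa [this] at hd

theorem analyticAt_cost (h : IsRiccatiPath K Q A C W) (hδ : 0 < δ) :
    AnalyticAt ℝ (fun δ => trace (Q * C (gain K A (W δ)))) δ := by
  refine (h.analyticAt_value hδ).deriv.congr ?_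
  filter_upwards [lt_mem_nhds hδ] with t ht using (h.hasDerivAt_value ht).deriv

/-- If the closed loop `γ` were stationary, differentiating the Riccati equation would give `W' γ =
0` and `W' = Q`, hence `γ = 0`, and then `A = 0`. -/
theorem deriv_gain_ne_zero (h : IsRiccatiPath K Q A C W) (hδ : 0 < δ)
    {η : Matrix (Fin n) (Fin n) ℝ} (hη : HasDerivAt (fun δ => gain K A (W δ)) η δ) : η ≠ 0 := by
  rintro rfl
  have hW : DifferentiableAt ℝ W δ :=
    (analyticAt_fst.comp (riccati_analyticAt h.posDef_K h.posDef_Q h.riccati hδ)).differentiableAt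
  have hd := hW.hasDerivAt
  set W' := deriv W δ
  set γ := gain K A (W δ)
  have e1 : HasDerivAt (fun t => (1 + (2 : ℝ) • (K * W t)) * gain K A (W t))
      ((2 : ℝ) • (K * W') * γ + (1 + (2 : ℝ) • (K * W δ)) * 0) δ :=
    (((hd.const_mul K).const_smul (2 : ℝ)).const_add 1).mul hη
  have e2 : HasDerivAt (fun t => (1 + (2 : ℝ) • (K * W t)) * gain K A (W t)) 0 δ := by
    refine (hasDerivAt_const δ A).congr_of_eventuallyEq ?_
    filter_upwards [lt_mem_nhds hδ] with t ht
    exact mul_gain h.posDef_K (h.riccati t ht).1.posSemidef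
  have e3 := e1.unique e2
  rw [Matrix.mul_zero, add_zero, Matrix.smul_mul, smul_eq_zero, Matrix.mul_assoc] at e3
  have e4 : W' * γ = 0 :=
    h.posDef_K.isUnit.mul_right_eq_zero.1 (e3.resolve_left two_ne_zero)
  have e5 : HasDerivAt (fun t => t • Q + Aᵀ * W t * gain K A (W t))
      ((1 : ℝ) • Q + (Aᵀ * W' * γ + Aᵀ * W δ * 0)) δ :=
    ((hasDerivAt_id δ).smul_const Q).add ((hd.const_mul Aᵀ).mul hη)
  have e6 : HasDerivAt (fun t => t • Q + Aᵀ * W t * gain K A (W t)) W' δ := by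
    refine hd.congr_of_eventuallyEq ?_
    filter_upwards [lt_mem_nhds hδ] with t ht
    exact (h.riccati t ht).2.symm
  have e7 := e5.unique e6
  rw [Matrix.mul_assoc Aᵀ, e4, Matrix.mul_zero, Matrix.mul_zero, add_zero, add_zero, one_smul] at e7
  rw [← e7] at e4
  exact h.gain_ne_zero hδ (h.posDef_Q.isUnit.mul_right_eq_zero.1 e4)

/-- The optimality gaps at `δ` and `δ₀` add up to `-(δ - δ₀)` times the increment of the cost, so
the difference quotient of the cost is at most `-tr (G (s S sᵀ))` with
`G = ½ K⁻¹ + W` and `s` the slope of the closed loop. -/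
theorem deriv_cost_neg (h : IsRiccatiPath K Q A C W) (hδ₀ : 0 < δ₀) :
    deriv (fun δ => trace (Q * C (gain K A (W δ)))) δ₀ < 0 := by
  have hη := (h.analyticAt_gain hδ₀).differentiableAt.hasDerivAt
  have hη0 := h.deriv_gain_ne_zero hδ₀ hη
  set η := deriv (fun δ => gain K A (W δ)) δ₀
  have hW : ContinuousAt W δ₀ :=
    (analyticAt_fst.comp (riccati_analyticAt h.posDef_K h.posDef_Q h.riccati hδ₀)).continuousAt
  set S := C (gain K A (W δ₀))
  have hSp : S.PosDef := h.posDef_cov (h.stable hδ₀)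
  have hslope := (hasDerivAt_iff_tendsto_slope.1 hη)
  have hcd := hasDerivAt_iff_tendsto_slope.1 (h.analyticAt_cost hδ₀).differentiableAt.hasDerivAt
  have hcont : Continuous fun p : Matrix (Fin n) (Fin n) ℝ × Matrix (Fin n) (Fin n) ℝ =>
      -trace (((1 / 2 : ℝ) • K⁻¹ + p.1) * (p.2 * S * p.2ᵀ)) := by fun_prop
  have hlim := (hcont.tendsto (W δ₀, η)).comp
    ((hW.tendsto.mono_left nhdsWithin_le_nhds).prodMk_nhds hslope)
  refine lt_of_le_of_lt (le_of_tendsto_of_tendsto hcd hlim ?_)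
    (neg_lt_zero.2 (trace_mul_conj_pos (posDef_inv_add h.posDef_K (h.riccati δ₀ hδ₀).1.posSemidef)
      hSp hη0))
  filter_upwards [self_mem_nhdsWithin, nhdsWithin_le_nhds (lt_mem_nhds hδ₀)] with δ hne hδ
  have hne' : δ - δ₀ ≠ 0 := sub_ne_zero.2 hne
  have g1 := h.gap_eq hδ (h.stable hδ₀)
  have g2 := h.value_le hδ₀ (h.stable hδ)
  have g3 := h.value_eq hδ₀
  have g4 := h.value_eq hδ
  simp only [Function.comp_apply, slope_def_module]
  rw [smul_eq_mul, inv_mul_eq_div]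
  have hE : trace (((1 / 2 : ℝ) • K⁻¹ + W δ) *
      (((δ - δ₀)⁻¹ • (gain K A (W δ) - gain K A (W δ₀))) * S *
        ((δ - δ₀)⁻¹ • (gain K A (W δ) - gain K A (W δ₀)))ᵀ)) =
      trace (((1 / 2 : ℝ) • K⁻¹ + W δ) *
        ((gain K A (W δ₀) - gain K A (W δ)) * S * (gain K A (W δ₀) - gain K A (W δ))ᵀ)) /
        (δ - δ₀) ^ 2 := by
    rw [← neg_sub (gain K A (W δ₀)) (gain K A (W δ))]
    simp only [Matrix.smul_mul, Matrix.mul_smul, transpose_smul, transpose_neg, Matrix.neg_mul,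
      Matrix.mul_neg, smul_neg, neg_neg, trace_smul, smul_eq_mul]
    field_simp
  have hq : (trace (Q * C (gain K A (W δ))) - trace (Q * C (gain K A (W δ₀)))) / (δ - δ₀) =
      (trace (Q * C (gain K A (W δ))) - trace (Q * C (gain K A (W δ₀)))) * (δ - δ₀) /
        (δ - δ₀) ^ 2 := by
    field_simp
  rw [hE, ← neg_div, hq]
  refine div_le_div_of_nonneg_right ?_ (sq_nonneg _)
  linarith

theorem value_sub_cost_eventuallyEq (h : IsRiccatiPath K Q A C W) (hδ : 0 < δ) :
    (fun δ => trace (W δ * K) - δ * trace (Q * C (gain K A (W δ)))) =ᶠ[𝓝 δ]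
      fun δ => rateOf K A (gain K A (W δ)) (C (gain K A (W δ))) := by
  filter_upwards [lt_mem_nhds hδ] with t ht
  rw [h.value_eq ht]; ring

theorem analyticAt_rate (h : IsRiccatiPath K Q A C W) (hδ : 0 < δ) :
    AnalyticAt ℝ (fun δ => rateOf K A (gain K A (W δ)) (C (gain K A (W δ)))) δ :=
  ((h.analyticAt_value hδ).sub (analyticAt_id.mul (h.analyticAt_cost hδ))).congr
    (h.value_sub_cost_eventuallyEq hδ)

/-- Since the cost `c` is the derivative of the value `v`, the derivative of `v - δ c` is `-δ c'`.
-/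
theorem deriv_rate_pos (h : IsRiccatiPath K Q A C W) (hδ : 0 < δ) :
    0 < deriv (fun δ => rateOf K A (gain K A (W δ)) (C (gain K A (W δ)))) δ := by
  rw [← (h.value_sub_cost_eventuallyEq hδ).deriv_eq]
  have hd : HasDerivAt (fun δ => trace (W δ * K) - δ * trace (Q * C (gain K A (W δ)))) _ δ :=
    (h.hasDerivAt_value hδ).sub ((hasDerivAt_id δ).mul
      (h.analyticAt_cost hδ).differentiableAt.hasDerivAt)
  rw [hd.deriv]
  have := mul_pos_of_neg_of_neg (neg_lt_zero.2 hδ) (h.deriv_cost_neg hδ)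
  simp only [id]
  linarith

theorem strictMonoOn_rate (h : IsRiccatiPath K Q A C W) :
    StrictMonoOn (fun δ => rateOf K A (gain K A (W δ)) (C (gain K A (W δ)))) (Set.Ioi 0) := by
  refine strictMonoOn_of_deriv_pos (convex_Ioi 0)
    (fun δ hδ => (h.analyticAt_rate hδ).continuousAt.continuousWithinAt) fun δ hδ => ?_
  rw [interior_Ioi] at hδ
  exact h.deriv_rate_pos hδ

/-- As the state cost gains weight, comparison with `θ = 0` bounds `tr (Q γ K γᵀ)` by a multiple of
`1 / δ`. -/
theorem tendsto_gain_atTop (h : IsRiccatiPath K Q A C W) :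
    Tendsto (fun δ => gain K A (W δ)) atTop (𝓝 0) := by
  refine tendsto_zero_of_trace h.posDef_Q h.posDef_K ?_
  have hlim : Tendsto (fun δ : ℝ => rateOf K A 0 K / δ) atTop (𝓝 0) :=
    tendsto_const_nhds.div_atTop tendsto_id
  refine squeeze_zero' ?_ ?_ hlim
  · exact Eventually.of_forall fun δ => h.posDef_Q.posSemidef.trace_mul_nonneg
      (h.posDef_K.posSemidef.mul_mul_transpose _)
  · filter_upwards [eventually_gt_atTop 0] with δ hδ
    rw [le_div_iff₀ hδ]
    have h1 := h.value_le hδ zero_mem_stableSet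
    rw [h.value_eq hδ, h.cov_zero] at h1
    have h2 := h.rate_nonneg (h.stable hδ)
    set γ := gain K A (W δ)
    have hL := h.lyapunov γ (h.stable hδ)
    have hSp := (h.posDef_cov (h.stable hδ)).posSemidef
    have h3 : trace (Q * (γ * K * γᵀ)) ≤ trace (Q * C γ) - trace (Q * K) := by
      have hd : C γ - K - γ * K * γᵀ = γ * (γ * C γ * γᵀ) * γᵀ := by
        nth_rw 1 [hL]; nth_rw 1 [hL]; noncomm_ring
      have := h.posDef_Q.posSemidef.trace_mul_nonneg (N := C γ - K - γ * K * γᵀ) (by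
          rw [hd]; exact (hSp.mul_mul_transpose γ).mul_mul_transpose γ)
      rw [Matrix.mul_sub, Matrix.mul_sub, trace_sub, trace_sub] at this
      linarith
    nlinarith

theorem rate_le_zero_rate (h : IsRiccatiPath K Q A C W) (hδ : 0 < δ) :
    rateOf K A (gain K A (W δ)) (C (gain K A (W δ))) ≤ rateOf K A 0 (C 0) := by
  have h1 := h.value_le hδ zero_mem_stableSet
  rw [h.value_eq hδ] at h1
  set γ := gain K A (W δ)
  have h2 : trace (Q * C 0) ≤ trace (Q * C γ) := by
    have := h.posDef_Q.posSemidef.trace_mul_nonneg (N := C γ - C 0) (by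
      have hL := h.lyapunov γ (h.stable hδ)
      rw [h.cov_zero]
      nth_rw 1 [hL]
      simpa using (h.posDef_cov (h.stable hδ)).posSemidef.mul_mul_transpose γ)
    rw [Matrix.mul_sub, trace_sub] at this
    linarith
  nlinarith

theorem exists_rate_gt (h : IsRiccatiPath K Q A C W) (hr : r < rateOf K A 0 (C 0)) :
    ∃ δ, 0 < δ ∧ r < rateOf K A (gain K A (W δ)) (C (gain K A (W δ))) := by
  have hc : Continuous fun θ => rateOf K A θ K := by unfold rateOf; fun_prop
  rw [h.cov_zero] at hr
  have hev := ((hc.tendsto 0).comp h.tendsto_gain_atTop).eventually (lt_mem_nhds hr)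
  obtain ⟨δ, hδr, hδ⟩ := (hev.and (eventually_gt_atTop 0)).exists
  refine ⟨δ, hδ, lt_of_lt_of_le hδr ?_⟩
  simp only [Function.comp_apply, rateOf_eq, trace_conj]
  set γ := gain K A (W δ)
  have := (h.posDef_K.inv.smul (by norm_num : (0 : ℝ) < 1 / 2)).posSemidef.trace_mul_nonneg
    (N := (A - γ) * (C γ - K) * (A - γ)ᵀ) (PosSemidef.mul_mul_transpose (by
      nth_rw 1 [h.lyapunov γ (h.stable hδ)]
      simpa using (h.posDef_cov (h.stable hδ)).posSemidef.mul_mul_transpose γ) _)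
  rw [Matrix.mul_sub (A - γ), Matrix.sub_mul (_ * C γ), Matrix.mul_sub, trace_sub] at this
  linarith

theorem exists_rate_lt (h : IsRiccatiPath K Q A C W) (hθ : θ ∈ stableSet n)
    (hr : rateOf K A θ (C θ) < r) :
    ∃ δ, 0 < δ ∧ rateOf K A (gain K A (W δ)) (C (gain K A (W δ))) < r := by
  have hc := h.cost_nonneg hθ
  set c := trace (Q * C θ)
  -- `δ` is so small that adding `δ c` to the rate of `θ` does not reach `r`
  refine ⟨(r - rateOf K A θ (C θ)) / (c + 1), div_pos (sub_pos.2 hr) (by positivity), ?_⟩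
  have hδ : 0 < (r - rateOf K A θ (C θ)) / (c + 1) := div_pos (sub_pos.2 hr) (by positivity)
  set δ := (r - rateOf K A θ (C θ)) / (c + 1) with hδdef
  have h1 := h.value_le hδ hθ
  rw [h.value_eq hδ] at h1
  have h2 := h.cost_nonneg (h.stable hδ)
  have h3 : δ * (c + 1) = r - rateOf K A θ (C θ) := div_mul_cancel₀ _ (by positivity)
  nlinarith [mul_nonneg hδ.le h2]

end IsRiccatiPath

end Rate
end StableId

/-! ### The invariant law and its covariance -/

namespace StableId
open Filter Topology ProbabilityTheory
open scoped ENNReal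

section Invariant

variable {n : ℕ} {θ : Matrix (Fin n) (Fin n) ℝ} {μ ν : Measure (Fin n → ℝ)}

/-- The continuous linear map `x ↦ θ x`. -/
noncomputable def mulVecCLM (θ : Matrix (Fin n) (Fin n) ℝ) : (Fin n → ℝ) →L[ℝ] (Fin n → ℝ) :=
  LinearMap.toContinuousLinearMap θ.mulVecLin

@[simp] theorem mulVecCLM_apply (θ : Matrix (Fin n) (Fin n) ℝ) (x : Fin n → ℝ) :
    mulVecCLM θ x = θ *ᵥ x := rfl

theorem charFunDual_step [IsProbabilityMeasure ν] [IsProbabilityMeasure μ]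
    (L : StrongDual ℝ (Fin n → ℝ)) :
    charFunDual ((ν.prod μ).map fun p : (Fin n → ℝ) × (Fin n → ℝ) => θ *ᵥ p.1 + p.2) L =
      charFunDual ν (L.comp (mulVecCLM θ)) * charFunDual μ L := by
  have hF : (fun p : (Fin n → ℝ) × (Fin n → ℝ) => θ *ᵥ p.1 + p.2) =
      ⇑((mulVecCLM θ).comp (ContinuousLinearMap.fst ℝ (Fin n → ℝ) (Fin n → ℝ)) +
        ContinuousLinearMap.snd ℝ (Fin n → ℝ) (Fin n → ℝ)) := rfl
  rw [hF, charFunDual_map, charFunDual_prod]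
  congr 2
  · ext x; simp
  · ext x; simp

theorem charFunDual_iterate [IsProbabilityMeasure μ] (h : IsInvariantLaw θ μ ν) (k : ℕ)
    (L : StrongDual ℝ (Fin n → ℝ)) :
    charFunDual ν L = charFunDual ν (L.comp (mulVecCLM (θ ^ k))) *
      ∏ j ∈ Finset.range k, charFunDual μ (L.comp (mulVecCLM (θ ^ j))) := by
  have := h.1
  induction k with
  | zero =>
    have : L.comp (mulVecCLM (θ ^ 0)) = L := by ext x; simp
    rw [this]; simp
  | succ k ih =>
    rw [ih, Finset.prod_range_succ]
    have h1 : charFunDual ν (L.comp (mulVecCLM (θ ^ k))) =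
        charFunDual ν (L.comp (mulVecCLM (θ ^ (k + 1)))) *
          charFunDual μ (L.comp (mulVecCLM (θ ^ k))) := by
      nth_rw 1 [← h.2]
      rw [charFunDual_step]
      congr 2
      ext x
      simp [pow_succ]
    rw [h1]; ring

theorem tendsto_charFunDual_pow [IsProbabilityMeasure ν] (hθ : θ ∈ stableSet n)
    (L : StrongDual ℝ (Fin n → ℝ)) :
    Tendsto (fun k : ℕ => charFunDual ν (L.comp (mulVecCLM (θ ^ k)))) atTop (𝓝 1) := by
  have h1 : (1 : ℂ) = ∫ _x, (1 : ℂ) ∂ν := by simp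
  rw [h1]
  simp only [charFunDual_apply]
  refine tendsto_integral_of_dominated_convergence (fun _ => 1) (fun k => ?_)
    (integrable_const _) (fun k => Eventually.of_forall fun x => ?_)
    (Eventually.of_forall fun x => ?_)
  · exact (by fun_prop : Continuous fun x : Fin n → ℝ =>
      Complex.exp (((L.comp (mulVecCLM (θ ^ k))) x : ℂ) * Complex.I)).aestronglyMeasurable
  · rw [Complex.norm_exp_ofReal_mul_I]
  · have hc : Continuous fun M : Matrix (Fin n) (Fin n) ℝ =>
        Complex.exp ((L (M *ᵥ x) : ℂ) * Complex.I) := by fun_prop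
    simpa [Function.comp_def] using (hc.tendsto 0).comp (mem_stableSet_iff_tendsto.1 hθ)

/-- Iterating the invariance expresses both characteristic functions through the same bounded
product; the remaining factors tend to one. -/
theorem IsInvariantLaw.unique [IsProbabilityMeasure μ] {ν' : Measure (Fin n → ℝ)}
    (hθ : θ ∈ stableSet n) (h : IsInvariantLaw θ μ ν) (h' : IsInvariantLaw θ μ ν') : ν = ν' := by
  have := h.1
  have := h'.1
  refine Measure.ext_of_charFunDual (funext fun L => sub_eq_zero.1 ?_)
  have hlim := ((tendsto_charFunDual_pow (ν := ν) hθ L).sub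
    (tendsto_charFunDual_pow (ν := ν') hθ L)).norm
  rw [sub_self, norm_zero] at hlim
  refine norm_le_zero_iff.1 (ge_of_tendsto hlim (Eventually.of_forall fun k => ?_))
  rw [charFunDual_iterate h k, charFunDual_iterate h' k, ← sub_mul, norm_mul]
  refine mul_le_of_le_one_right (norm_nonneg _) ?_
  rw [norm_prod]
  refine Finset.prod_le_one (fun _ _ => norm_nonneg _) fun j _ => ?_
  rw [charFunDual_apply]
  refine (norm_integral_le_of_norm_le_const (C := 1) (Eventually.of_forall fun x => ?_)).trans
    (by simp)
  rw [Complex.norm_exp_ofReal_mul_I]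

section

attribute [local instance] Matrix.linftyOpNormedRing Matrix.linftyOpNormedAlgebra

theorem summable_norm_mulVecCLM_pow (hθ : θ ∈ stableSet n) :
    Summable fun k : ℕ => ‖mulVecCLM (θ ^ k)‖ := by
  obtain ⟨c, hc0, hc1, hc⟩ := exists_norm_pow_le hθ
  refine (summable_geometric_of_lt_one hc0 hc1).of_norm_bounded_eventually_nat ?_
  filter_upwards [hc] with k hk
  rw [norm_norm]
  exact ((mulVecCLM (θ ^ k)).opNorm_le_bound (norm_nonneg _)
    fun x => Matrix.linfty_opNorm_mulVec _ x).trans hk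

end

theorem tendsto_charFunDual_of_tendstoInMeasure {Ω : Type*} {mΩ : MeasurableSpace Ω}
    {P : Measure Ω} [IsProbabilityMeasure P] {Y : ℕ → Ω → (Fin n → ℝ)} {X : Ω → (Fin n → ℝ)}
    (hY : ∀ k, AEMeasurable (Y k) P) (h : TendstoInMeasure P Y atTop X)
    (L : StrongDual ℝ (Fin n → ℝ)) :
    Tendsto (fun k => charFunDual (P.map (Y k)) L) atTop (𝓝 (charFunDual (P.map X) L)) := by
  have hd := (h.tendstoInDistribution hY).tendsto
  have := (ProbabilityMeasure.tendsto_iff_forall_integral_rclike_tendsto ℂ).1 hd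
    (BoundedContinuousFunction.ofNormedAddCommGroup
      (fun x : Fin n → ℝ => Complex.exp ((L x : ℂ) * Complex.I)) (by fun_prop) 1
      (fun x => by rw [Complex.norm_exp_ofReal_mul_I]))
  simpa [charFunDual_apply] using this

/-- The law of the series `∑ θ ^ k w_k`, which converges in `L²` for i.i.d. `w_k`, is invariant.
Invariance is checked on the characteristic functions of the partial sums. -/
theorem exists_invariantLaw [IsProbabilityMeasure μ] (hθ : θ ∈ stableSet n)
    (hμ : MemLp id 2 μ) : ∃ ν, IsInvariantLaw θ μ ν ∧ MemLp id 2 ν := by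
  let P : Measure (ℕ → Fin n → ℝ) := Measure.infinitePi fun _ => μ
  have hev : ∀ k : ℕ, MeasurePreserving (fun ω : ℕ → Fin n → ℝ => ω k) P μ := fun k =>
    measurePreserving_eval_infinitePi (fun _ => μ) k
  have hw : ∀ k : ℕ, MemLp (fun ω : ℕ → Fin n → ℝ => ω k) 2 P := fun k =>
    hμ.comp_measurePreserving (hev k)
  let ζ : ℕ → (ℕ → Fin n → ℝ) → (Fin n → ℝ) := fun k ω => mulVecCLM (θ ^ k) (ω k)
  have hζ : ∀ k, MemLp (ζ k) 2 P := fun k => (mulVecCLM (θ ^ k)).comp_memLp' (hw k)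
  let ξ : ℕ → Lp (Fin n → ℝ) 2 P := fun k => (mulVecCLM (θ ^ k)).compLp ((hw k).toLp)
  have hξ : ∀ k, ξ k =ᵐ[P] ζ k := fun k => by
    filter_upwards [(mulVecCLM (θ ^ k)).coeFn_compLp' ((hw k).toLp), (hw k).coeFn_toLp]
      with ω h1 h2
    rw [h1, h2]
  have hsum : Summable ξ := by
    refine ((summable_norm_mulVecCLM_pow hθ).mul_right (eLpNorm id 2 μ).toReal).of_norm_bounded
      fun k => ((mulVecCLM (θ ^ k)).norm_compLp_le _).trans_eq ?_
    rw [Lp.norm_toLp, ← eLpNorm_comp_measurePreserving hμ.1 (hev k)]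
    rfl
  obtain ⟨X, hX⟩ := hsum
  let Y : ℕ → (ℕ → Fin n → ℝ) → (Fin n → ℝ) := fun N ω => ∑ k ∈ Finset.range N, ζ k ω
  have hYae : ∀ N, AEMeasurable (Y N) P := by
    intro N
    fun_prop
  have hYX : TendstoInMeasure P Y atTop X := by
    refine (tendstoInMeasure_of_tendsto_Lp hX.tendsto_sum_nat).congr_left fun N => ?_
    refine (Lp.coeFn_finsetSum _ _).trans ?_
    have : ∀ᵐ ω ∂P, ∀ k, ξ k ω = ζ k ω := ae_all_iff.2 hξ
    filter_upwards [this] with ω hω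
    simp [Y, hω]
  have hcf : ∀ N (L : StrongDual ℝ (Fin n → ℝ)), charFunDual (P.map (Y N)) L =
      ∏ k ∈ Finset.range N, charFunDual μ (L.comp (mulVecCLM (θ ^ k))) := by
    intro N L
    have hind : iIndepFun ζ P := iIndepFun_infinitePi (P := fun _ => μ)
      (X := fun k x => mulVecCLM (θ ^ k) x) (fun k => by fun_prop)
    rw [show Y N = fun ω => ∑ k ∈ Finset.range N, ζ k ω from rfl,
      iIndepFun.charFunDual_map_fun_finsetSum_eq_prod
        (fun k _ => (hζ k).aestronglyMeasurable.aemeasurable)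
      (hind.restrict _), Finset.prod_apply]
    refine Finset.prod_congr rfl fun k _ => ?_
    rw [← charFunDual_map, ← (hev k).map_eq, Measure.map_map (by fun_prop) (by fun_prop)]
    rfl
  have hXae : AEMeasurable X P := (Lp.aestronglyMeasurable X).aemeasurable
  have hν : IsProbabilityMeasure (P.map X) := Measure.isProbabilityMeasure_map hXae
  refine ⟨P.map X, ⟨hν, ?_⟩, ?_⟩
  · refine Measure.ext_of_charFunDual (funext fun L => ?_)
    rw [charFunDual_step]
    have h1 := tendsto_charFunDual_of_tendstoInMeasure hYae hYX L
    have h2 := (tendsto_charFunDual_of_tendstoInMeasure hYae hYX (L.comp (mulVecCLM θ))).mul_const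
      (charFunDual μ L)
    refine tendsto_nhds_unique (h2.congr fun N => ?_) (h1.comp (tendsto_add_atTop_nat 1))
    simp only [Function.comp_apply, hcf]
    rw [Finset.prod_range_succ']
    congr 1
    · refine Finset.prod_congr rfl fun k _ => ?_
      congr 1
      ext x
      simp [pow_succ']
    · congr 1
      ext x
      simp
  · exact (memLp_map_measure_iff aestronglyMeasurable_id hXae).2 (Lp.memLp X)

theorem covariance_step [IsProbabilityMeasure ν] [IsProbabilityMeasure μ]
    (hν : MemLp id 2 ν) (hμ : MemLp id 2 μ) (i j : Fin n) :
    covariance (fun x : Fin n → ℝ => x i) (fun x => x j)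
      ((ν.prod μ).map fun p : (Fin n → ℝ) × (Fin n → ℝ) => θ *ᵥ p.1 + p.2) =
    (∑ k, ∑ l, θ i k * θ j l * covariance (fun x : Fin n → ℝ => x k) (fun x => x l) ν) +
      covariance (fun x : Fin n → ℝ => x i) (fun x => x j) μ := by
  have hν' : ∀ i, MemLp (fun x : Fin n → ℝ => x i) 2 ν := fun i => hν.eval i
  have hμ' : ∀ i, MemLp (fun x : Fin n → ℝ => x i) 2 μ := fun i => hμ.eval i
  have h1 : ∀ i, MemLp (fun p : (Fin n → ℝ) × (Fin n → ℝ) => p.1 i) 2 (ν.prod μ) :=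
    fun i => (hν' i).comp_fst μ
  have h2 : ∀ i, MemLp (fun p : (Fin n → ℝ) × (Fin n → ℝ) => p.2 i) 2 (ν.prod μ) :=
    fun i => (hμ' i).comp_snd ν
  have h3 : ∀ i k, MemLp (fun p : (Fin n → ℝ) × (Fin n → ℝ) => θ i k * p.1 k) 2 (ν.prod μ) :=
    fun i k => (h1 k).const_mul _
  have h4 : ∀ i, MemLp (fun p : (Fin n → ℝ) × (Fin n → ℝ) => ∑ k, θ i k * p.1 k) 2 (ν.prod μ) :=
    fun i => memLp_finsetSum _ fun k _ => h3 i k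
  have hfst : ∀ k l, covariance (fun p : (Fin n → ℝ) × (Fin n → ℝ) => p.1 k) (fun p => p.1 l)
      (ν.prod μ) = covariance (fun x : Fin n → ℝ => x k) (fun x => x l) ν := by
    intro k l
    have := covariance_map_fun (μ := ν.prod μ) (X := fun x : Fin n → ℝ => x k)
      (Y := fun x => x l) (Z := Prod.fst) (measurable_pi_apply k).aestronglyMeasurable
      (measurable_pi_apply l).aestronglyMeasurable measurable_fst.aemeasurable
    rw [measurePreserving_fst.map_eq] at this
    exact this.symm
  have hsnd : ∀ k l, covariance (fun p : (Fin n → ℝ) × (Fin n → ℝ) => p.2 k) (fun p => p.2 l)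
      (ν.prod μ) = covariance (fun x : Fin n → ℝ => x k) (fun x => x l) μ := by
    intro k l
    have := covariance_map_fun (μ := ν.prod μ) (X := fun x : Fin n → ℝ => x k)
      (Y := fun x => x l) (Z := Prod.snd) (measurable_pi_apply k).aestronglyMeasurable
      (measurable_pi_apply l).aestronglyMeasurable measurable_snd.aemeasurable
    rw [measurePreserving_snd.map_eq] at this
    exact this.symm
  have hx : ∀ i j, covariance (fun p : (Fin n → ℝ) × (Fin n → ℝ) => ∑ k, θ i k * p.1 k)
      (fun p => p.2 j) (ν.prod μ) = 0 := fun i j =>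
    covariance_fst_snd_prod (X := fun x : Fin n → ℝ => ∑ k, θ i k * x k)
      (Y := fun x : Fin n → ℝ => x j)
      (memLp_finsetSum _ fun k _ => (hν' k).const_mul _) (hμ' j)
  rw [covariance_map_fun (measurable_pi_apply i).aestronglyMeasurable
    (measurable_pi_apply j).aestronglyMeasurable
    (by fun_prop : Measurable fun p : (Fin n → ℝ) × (Fin n → ℝ) => θ *ᵥ p.1 + p.2).aemeasurable]
  change covariance (((fun p : (Fin n → ℝ) × (Fin n → ℝ) => ∑ k, θ i k * p.1 k) + fun p => p.2 i))
    ((fun p : (Fin n → ℝ) × (Fin n → ℝ) => ∑ k, θ j k * p.1 k) + fun p => p.2 j) (ν.prod μ) = _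
  rw [covariance_add_left (h4 i) (h2 i) ((h4 j).add (h2 j)),
    covariance_add_right (h4 i) (h4 j) (h2 j), covariance_add_right (h2 i) (h4 j) (h2 j),
    covariance_comm (fun p : (Fin n → ℝ) × (Fin n → ℝ) => p.2 i), hx, hx, hsnd,
    covariance_fun_sum_fun_sum (h3 i) (h3 j)]
  simp only [covariance_const_mul_left, covariance_const_mul_right, hfst, add_zero, zero_add]
  congr 1
  refine Finset.sum_congr rfl fun k _ => Finset.sum_congr rfl fun l _ => ?_
  ring

theorem stateCov_lyapunov {Sw : Matrix (Fin n) (Fin n) ℝ}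
    {μ : Matrix (Fin n) (Fin n) ℝ → Measure (Fin n → ℝ)} (hθ : θ ∈ stableSet n)
    (hμ : IsNoiseLaw Sw (μ θ)) : stateCov μ θ = θ * stateCov μ θ * θᵀ + Sw := by
  have := hμ.isProbabilityMeasure
  have hμ2 : MemLp id 2 (μ θ) := MemLp.of_eval hμ.memLp
  obtain ⟨ν, hν, hν2⟩ := exists_invariantLaw hθ hμ2
  have hprob := hν.1
  have hinv : invariantLaw θ (μ θ) = ν := by
    rw [invariantLaw, dif_pos ⟨ν, hν⟩]
    exact IsInvariantLaw.unique hθ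
      (Classical.choose_spec (⟨ν, hν⟩ : ∃ ν, IsInvariantLaw θ (μ θ) ν)) hν
  ext i j
  have hcov : ∀ k l, stateCov μ θ k l =
      covariance (fun x : Fin n → ℝ => x k) (fun x => x l) ν := by
    intro k l
    rw [stateCov, hinv, of_apply]
  have hSw : covariance (fun x : Fin n → ℝ => x i) (fun x => x j) (μ θ) = Sw i j := by
    rw [covariance_eq_sub (hμ.memLp i) (hμ.memLp j), hμ.mean_zero, hμ.mean_zero]
    simpa using hμ.second_moment i j
  rw [hcov]
  nth_rw 1 [← hν.2]
  rw [covariance_step hν2 hμ2, hSw, Matrix.add_apply, Matrix.mul_apply]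
  congr 1
  simp only [Matrix.mul_apply, transpose_apply, Finset.sum_mul, hcov]
  rw [Finset.sum_comm]
  refine Finset.sum_congr rfl fun k _ => Finset.sum_congr rfl fun l _ => ?_
  ring

end Invariant
end StableId

/-! ### Inverting the rate -/

namespace StableId
open Filter Topology

section Inverse

theorem analyticOnNhd_invFunOn {r : ℝ → ℝ} {s : Set ℝ} (hs : IsOpen s)
    (hr : AnalyticOnNhd ℝ r s) (hd : ∀ x ∈ s, deriv r x ≠ 0) (hinj : Set.InjOn r s) :
    AnalyticOnNhd ℝ (Function.invFunOn r s) (r '' s) := by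
  rintro _ ⟨x, hx, rfl⟩
  have ha := hr x hx
  refine (ha.analyticAt_localInverse (hd x hx)).congr ?_
  have h1 := ha.hasStrictDerivAt.eventually_right_inverse (hd x hx)
  have h2 := (ha.analyticAt_localInverse (hd x hx)).continuousAt
  have h3 : (ha.hasStrictDerivAt.localInverse r (deriv r x) x (hd x hx)) (r x) = x :=
    HasStrictFDerivAt.localInverse_apply_image ..
  have h4 := h2.eventually (hs.mem_nhds (by rw [h3]; exact hx))
  filter_upwards [h1, h4] with y hy1 hy2
  have := hinj.leftInvOn_invFunOn hy2
  nth_rw 2 [← hy1]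
  exact this.symm

end Inverse

section Image

variable {n : ℕ} {Sw Q A : Matrix (Fin n) (Fin n) ℝ}
  {μ : Matrix (Fin n) (Fin n) ℝ → Measure (Fin n → ℝ)} {W : ℝ → Matrix (Fin n) (Fin n) ℝ}

/-- Small `δ` brings the rate close to its infimum over all stable matrices, and large `δ` close to
the rate of the zero matrix; strict monotonicity excludes the endpoints. -/
theorem IsRiccatiPath.image_rate (h : IsRiccatiPath Sw Q A (stateCov μ) W) :
    (fun δ => rateFun Sw μ A (gain Sw A (W δ))) '' Set.Ioi 0 =
      Set.Ioo (rLow Sw μ A) (rHigh Sw μ A) := by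
  have hmono := h.strictMonoOn_rate
  change StrictMonoOn (fun δ => rateFun Sw μ A (gain Sw A (W δ))) (Set.Ioi 0) at hmono
  have hbdd : BddBelow {r : ℝ | 0 ≤ r ∧ (feasibleSet Sw μ A r).Nonempty} := ⟨0, fun r hr => hr.1⟩
  have hlow : ∀ δ, 0 < δ → rLow Sw μ A ≤ rateFun Sw μ A (gain Sw A (W δ)) := fun δ hδ =>
    csInf_le hbdd ⟨h.rate_nonneg (h.stable hδ), _, h.stable hδ, le_rfl⟩
  have hhigh : ∀ δ, 0 < δ → rateFun Sw μ A (gain Sw A (W δ)) ≤ rHigh Sw μ A := fun δ hδ =>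
    h.rate_le_zero_rate hδ
  ext r
  constructor
  · rintro ⟨δ, hδ : 0 < δ, rfl⟩
    have h2 : 0 < δ / 2 := by positivity
    have h3 : 0 < δ + 1 := by positivity
    exact ⟨(hlow _ h2).trans_lt (hmono h2 hδ (by linarith)),
      (hmono hδ h3 (by linarith)).trans_le (hhigh _ h3)⟩
  · rintro ⟨h1, h2⟩
    have hne : {r : ℝ | 0 ≤ r ∧ (feasibleSet Sw μ A r).Nonempty}.Nonempty :=
      ⟨_, h.rate_nonneg (h.stable one_pos), _, h.stable one_pos, le_rfl⟩
    obtain ⟨r', ⟨_, θ, hθ, hθr⟩, hr'⟩ := exists_lt_of_csInf_lt hne h1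
    obtain ⟨δ₁, hδ₁, hr₁⟩ := h.exists_rate_lt hθ (lt_of_le_of_lt hθr hr')
    obtain ⟨δ₂, hδ₂, hr₂⟩ := h.exists_rate_gt h2
    have hc : ContinuousOn (fun δ => rateFun Sw μ A (gain Sw A (W δ))) (Set.Ioi 0) :=
      fun δ hδ => (h.analyticAt_rate hδ).continuousAt.continuousWithinAt
    exact isPreconnected_Ioi.intermediate_value hδ₁ hδ₂ hc ⟨hr₁.le, hr₂.le⟩

theorem isRiccatiSolution_iff {P θ' : Matrix (Fin n) (Fin n) ℝ} {δ : ℝ} (hδ : 0 < δ) :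
    IsRiccatiSolution Sw Q θ' δ P ↔ IsRiccati Sw θ' (δ • Q) (δ • P) := by
  have hg : gain Sw θ' (δ • P) = (1 + (2 * δ) • (Sw * P))⁻¹ * θ' := by
    rw [gain, Matrix.mul_smul, smul_smul]
  unfold IsRiccatiSolution IsRiccati
  rw [hg, Matrix.mul_smul, Matrix.smul_mul, ← smul_add, ← Matrix.mul_assoc]
  refine and_congr ⟨fun h => h.smul hδ, fun h => ?_⟩ (smul_right_injective _ hδ.ne').eq_iff.symm
  simpa [smul_smul, inv_mul_cancel₀ hδ.ne'] using h.smul (inv_pos.2 hδ)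

end Image

end StableId

open StableId
theorem mainTheorem4 (n : ℕ) (Sw : Matrix (Fin n) (Fin n) ℝ) (hSw : Sw.PosDef)
    (μ : Matrix (Fin n) (Fin n) ℝ → MeasureTheory.Measure (Fin n → ℝ))
    (hμ : ∀ θ ∈ stableSet n, IsNoiseLaw Sw (μ θ))
    (Q : Matrix (Fin n) (Fin n) ℝ) (hQ : Q.PosDef)
    (θ' : Matrix (Fin n) (Fin n) ℝ) (hθ' : θ' ∉ stableSet n) :
    ∃ φ : ℝ → ℝ,
      AnalyticOnNhd ℝ φ (Set.Ioo (rLow Sw μ θ') (rHigh Sw μ θ')) ∧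
      StrictMonoOn φ (Set.Ioo (rLow Sw μ θ') (rHigh Sw μ θ')) ∧
      Set.BijOn φ (Set.Ioo (rLow Sw μ θ') (rHigh Sw μ θ')) (Set.Ioi 0) ∧
      (∀ δ : ℝ, 0 < δ → ∃! P : Matrix (Fin n) (Fin n) ℝ, IsRiccatiSolution Sw Q θ' δ P) ∧
      (∀ δ : ℝ, 0 < δ → ∀ r ∈ Set.Ioo (rLow Sw μ θ') (rHigh Sw μ θ'), φ r = δ →
        ∀ P : Matrix (Fin n) (Fin n) ℝ, IsRiccatiSolution Sw Q θ' δ P →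
          (∀ θ : Matrix (Fin n) (Fin n) ℝ,
            IsSolution Sw μ Q θ' r θ ↔ θ = thetaStar Sw θ' δ P) ∧
          rateFun Sw μ θ' (thetaStar Sw θ' δ P) = r) := by
  have hex : ∀ δ : ℝ, ∃ W, 0 < δ → IsRiccati Sw θ' (δ • Q) W := fun δ => by
    by_cases hδ : 0 < δ
    · exact (riccati_exists hSw (hQ.smul hδ) θ').imp fun W hW _ => hW
    · exact ⟨0, fun h => absurd h hδ⟩
  choose W hW using hex
  have h : IsRiccatiPath Sw Q θ' (stateCov μ) W :=
    { posDef_K := hSw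
      posDef_Q := hQ
      ne_zero := fun h0 => hθ' (h0 ▸ zero_mem_stableSet)
      lyapunov := fun θ hθ => stateCov_lyapunov hθ (hμ θ hθ)
      riccati := hW }
  set ρ : ℝ → ℝ := fun δ => rateFun Sw μ θ' (gain Sw θ' (W δ))
  have hmono : StrictMonoOn ρ (Set.Ioi 0) := h.strictMonoOn_rate
  have himg : ρ '' Set.Ioi 0 = Set.Ioo (rLow Sw μ θ') (rHigh Sw μ θ') := h.image_rate
  have hleft := hmono.injOn.leftInvOn_invFunOn
  rw [← himg]
  refine ⟨Function.invFunOn ρ (Set.Ioi 0), ?_, ?_, ?_, fun δ hδ => ?_, ?_⟩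
  · exact analyticOnNhd_invFunOn isOpen_Ioi (fun δ hδ => (h.analyticAt_rate hδ))
      (fun δ hδ => (h.deriv_rate_pos hδ).ne') hmono.injOn
  · rintro _ ⟨a, ha, rfl⟩ _ ⟨b, hb, rfl⟩ hab
    rw [hleft ha, hleft hb]
    exact (hmono.lt_iff_lt ha hb).1 hab
  · exact Set.InvOn.bijOn ⟨hmono.injOn.bijOn_image.surjOn.rightInvOn_invFunOn, hleft⟩
      (by rintro _ ⟨a, ha, rfl⟩; rwa [hleft ha]) (Set.mapsTo_image _ _)
  · refine ⟨δ⁻¹ • W δ, ?_, fun P hP => ?_⟩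
    · beta_reduce
      rw [isRiccatiSolution_iff hδ, smul_inv_smul₀ hδ.ne']
      exact hW δ hδ
    · beta_reduce at hP
      rw [isRiccatiSolution_iff hδ] at hP
      rw [← riccati_unique hSw (hQ.smul hδ) hP (hW δ hδ), inv_smul_smul₀ hδ.ne']
  · rintro δ hδ _ ⟨ε, hε, rfl⟩ hεδ P hP
    rw [hleft hε] at hεδ
    subst hεδ
    have hstar : thetaStar Sw θ' ε P = gain Sw θ' (W ε) := by
      rw [isRiccatiSolution_iff hδ] at hP
      rw [← riccati_unique hSw (hQ.smul hδ) hP (hW ε hδ), thetaStar, gain, Matrix.mul_smul,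
        smul_smul]
    rw [hstar]
    have hfeas : gain Sw θ' (W ε) ∈ feasibleSet Sw μ θ' (ρ ε) := ⟨h.stable hδ, le_rfl⟩
    have huniq : ∀ θ ∈ feasibleSet Sw μ θ' (ρ ε),
        trace (Q * stateCov μ θ) ≤ trace (Q * stateCov μ (gain Sw θ' (W ε))) →
          θ = gain Sw θ' (W ε) := fun θ hθ hle => h.eq_gain_of_le hδ hθ.1 hle hθ.2
    refine ⟨fun θ => ⟨fun hθ => huniq θ hθ.1 (hθ.2 hfeas), ?_⟩, rfl⟩
    rintro rfl
    refine ⟨hfeas, isMinOn_iff.2 fun η hη => ?_⟩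
    by_contra hlt
    exact hlt (by rw [huniq η hη (not_le.1 hlt).le])
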